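/- **Notation.** For a finite set $S\subset\mathbb R^d$ let $\mathbb E_S$ be the empirical average over $S$ and $\overline{\Sigma}_S=\mathbb E_S[xx^\top]$ the (uncentred) second moment matrix. For $H\subseteq[d]$, $(x)_H$ and $(A)_H$ denote the restrictions of a vector and of a $d\times d$ matrix to the coordinates in $H$. Put $\|A\|_{\mathrm{Fr},k^2}=\sup\{\operatorname{tr}(A^\top B):\|B\|_{\mathrm{Fr}}=1,\ B \text{ has at most } k^2 \text{ non-zero entries}\}$. **Covariance stability.** A finite family $(y_x)_{x\in S}$ in $\mathbb R^m$ is $(\epsilon,\gamma)$-covariance stable with respect to $\Sigma$ if for every symmetric $B$ with $2\operatorname{tr}(B\Sigma B\Sigma)=1$ (that is, $g^\top Bg$ has variance $1$ for $g\sim\mathcal N(0,\Sigma)$) and every $S'\subseteq S$ with $|S'|\ge(1-\epsilon)|S|$, the form $q(y)=y^\top By-\operatorname{tr}(B\Sigma)$ satisfies $|\mathbb E_{S'}[q(y_x)]|\le\gamma$ and $|\mathbb E_{S'}[q(y_x)^2]-1|\le\gamma^2/\epsilon$. (For invertible $\Sigma$ this is stability of the flattened, whitened matrices $\Sigma^{-1/2}y_xy_x^\top\Sigma^{-1/2}$,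 in isotropic normalization, with respect to the flattening of $I$.) **PCA-stability.** Let $\epsilon\in(0,1/2)$, $\gamma\ge\epsilon$, $\eta\ge0$, $k\in\mathbb N$, and let $v\in\mathbb R^d$ be a $k$-sparse unit vector. A finite set $S\subset\mathbb R^d$ is $(\epsilon,\gamma,k,\eta)$-pca-stable with respect to $v$ if (i) $\|\overline\Sigma_{S'}-(I_d+\eta vv^\top)\|_{\mathrm{Fr},k^2}\le\gamma$ for all $S'\subseteq S$ with $|S'|\ge(1-\epsilon)|S|$, and (ii) for all $H\subseteq[d]$ with $|H|\le k$, the family $((x)_H)_{x\in S}$ is $(\epsilon,\gamma)$-covariance stable with respect to $(I_d+\eta vv^\top)_H$. **Corruption.** $T$ is an $\epsilon$-corrupted version of $S$ if $|T|=|S|$ and $|S\cap T|\ge(1-\epsilon)|S|$. **Lemma (Sparse PCA Filter).** There are absolute constants $\epsilon_0>0$ and $C_0>0$ and a (deterministic) algorithm $\mathcal A$ such that the following holds for every $C\ge C_0$, $\epsilon\in(0,\epsilon_0)$, $\eta\in(0,1)$, $\gamma$, $d$ and $k$. Let $S\subset\mathbb R^d$ be a nonempty finite set that is $(\epsilon,\gamma,k,\eta)$-pca-stable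 with respect to a $k$-sparse unit vector $v$, let $T$ be an $\epsilon$-corrupted version of $S$, and let $H\subseteq[d]$ satisfy $|H|\le k$ and $$\big\|(\overline\Sigma_T-I-\eta vv^\top)_H\big\|_{\mathrm{Fr}}\ \ge\ 8C\gamma .$$ Then, given $T$, $H$, $\epsilon$, $\gamma$, $\eta$ (but neither $S$ nor $v$), with $T$ and $H$ listed in any order, $\mathcal A$ returns scores $f:T\to\mathbb R_{\ge0}$ with $$\sum_{x\in S\cap T}f(x)\ \le\ \sum_{x\in T\setminus S}f(x)\qquad\text{and}\qquad \max_{x\in T}f(x)>0 ,$$ and it runs in time $d\cdot\mathrm{poly}(k,|T|)$, with a polynomial that does not depend on any of the parameters. Here time is the number of steps of a real RAM with unit-cost real arithmetic, square roots and comparisons, and unit-cost addition and subtraction of indices. -/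

import Mathlib

attribute [local instance] Matrix.frobeniusNormedAddCommGroup

/-! ## A real RAM

Programs of a small imperative language over two kinds of memory: arrays of natural numbers (used
for indices and counters) and two-dimensional arrays of reals. Exact real arithmetic, real square
roots and comparisons have unit cost. Naturals have addition and truncated subtraction only, and
there is no rounding from the reals to the naturals. -/

namespace RealRAM

/-- Memory: `nat a i` is cell `i` of the `a`-th array of naturals; `real a i j` is cell `(i, j)` of
the `a`-th array of reals. -/
structure Mem where
  nat : ℕ → ℕ → ℕ
  real : ℕ → ℕ → ℕ → ℝ

/-- Expressions with values in the naturals. -/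
inductive NExp : Type
  | lit (n : ℕ)
  | get (a : ℕ) (i : NExp)
  | add (e₁ e₂ : NExp)
  | sub (e₁ e₂ : NExp)

/-- Expressions with real values. -/
inductive RExp : Type
  | ofNat (e : NExp)
  | get (a : ℕ) (i j : NExp)
  | add (e₁ e₂ : RExp)
  | sub (e₁ e₂ : RExp)
  | mul (e₁ e₂ : RExp)
  | div (e₁ e₂ : RExp)
  | sqrt (e : RExp)

/-- Tests. -/
inductive BExp : Type
  | natLT (e₁ e₂ : NExp)
  | realLT (e₁ e₂ : RExp)
  | not (b : BExp)
  | and (b₁ b₂ : BExp)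

/-- Programs. -/
inductive Prog : Type
  | skip
  | setNat (a : ℕ) (i e : NExp)
  | setReal (a : ℕ) (i j : NExp) (e : RExp)
  | seq (p q : Prog)
  | ite (b : BExp) (p q : Prog)
  | while (b : BExp) (p : Prog)

def NExp.eval (m : Mem) : NExp → ℕ
  | .lit n => n
  | .get a i => m.nat a (i.eval m)
  | .add e₁ e₂ => e₁.eval m + e₂.eval m
  | .sub e₁ e₂ => e₁.eval m - e₂.eval m

/-- The cost of evaluating an expression is the number of its nodes. -/
def NExp.cost : NExp → ℕ
  | .lit _ => 1
  | .get _ i => i.cost + 1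
  | .add e₁ e₂ => e₁.cost + e₂.cost + 1
  | .sub e₁ e₂ => e₁.cost + e₂.cost + 1

noncomputable def RExp.eval (m : Mem) : RExp → ℝ
  | .ofNat e => (e.eval m : ℝ)
  | .get a i j => m.real a (i.eval m) (j.eval m)
  | .add e₁ e₂ => e₁.eval m + e₂.eval m
  | .sub e₁ e₂ => e₁.eval m - e₂.eval m
  | .mul e₁ e₂ => e₁.eval m * e₂.eval m
  | .div e₁ e₂ => e₁.eval m / e₂.eval m
  | .sqrt e => Real.sqrt (e.eval m)

def RExp.cost : RExp → ℕ
  | .ofNat e => e.cost + 1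
  | .get _ i j => i.cost + j.cost + 1
  | .add e₁ e₂ => e₁.cost + e₂.cost + 1
  | .sub e₁ e₂ => e₁.cost + e₂.cost + 1
  | .mul e₁ e₂ => e₁.cost + e₂.cost + 1
  | .div e₁ e₂ => e₁.cost + e₂.cost + 1
  | .sqrt e => e.cost + 1

def BExp.Holds (m : Mem) : BExp → Prop
  | .natLT e₁ e₂ => e₁.eval m < e₂.eval m
  | .realLT e₁ e₂ => e₁.eval m < e₂.eval m
  | .not b => ¬ b.Holds m
  | .and b₁ b₂ => b₁.Holds m ∧ b₂.Holds m

def BExp.cost : BExp → ℕ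
  | .natLT e₁ e₂ => e₁.cost + e₂.cost + 1
  | .realLT e₁ e₂ => e₁.cost + e₂.cost + 1
  | .not b => b.cost + 1
  | .and b₁ b₂ => b₁.cost + b₂.cost + 1

/-- Overwrite one cell of an array of naturals. -/
def Mem.setNat (m : Mem) (a i x : ℕ) : Mem where
  nat := Function.update m.nat a (Function.update (m.nat a) i x)
  real := m.real

/-- Overwrite one cell of an array of reals. -/
noncomputable def Mem.setReal (m : Mem) (a i j : ℕ) (x : ℝ) : Mem where
  nat := m.nat
  real := Function.update m.real a
    (Function.update (m.real a) i (Function.update (m.real a i) j x))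

/-- `Exec p m m' t`: the program `p`, started in memory `m`, halts in memory `m'` after exactly `t`
steps. -/
inductive Exec : Prog → Mem → Mem → ℕ → Prop
  | skip (m : Mem) : Exec .skip m m 1
  | setNat (m : Mem) (a : ℕ) (i e : NExp) :
      Exec (.setNat a i e) m (m.setNat a (i.eval m) (e.eval m)) (i.cost + e.cost + 1)
  | setReal (m : Mem) (a : ℕ) (i j : NExp) (e : RExp) :
      Exec (.setReal a i j e) m (m.setReal a (i.eval m) (j.eval m) (e.eval m))
        (i.cost + j.cost + e.cost + 1)
  | seq {p q : Prog} {m₀ m₁ m₂ : Mem} {s t : ℕ} :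
      Exec p m₀ m₁ s → Exec q m₁ m₂ t → Exec (.seq p q) m₀ m₂ (s + t)
  | iteTrue {b : BExp} {p q : Prog} {m m' : Mem} {t : ℕ} :
      b.Holds m → Exec p m m' t → Exec (.ite b p q) m m' (b.cost + t)
  | iteFalse {b : BExp} {p q : Prog} {m m' : Mem} {t : ℕ} :
      ¬ b.Holds m → Exec q m m' t → Exec (.ite b p q) m m' (b.cost + t)
  | whileTrue {b : BExp} {p : Prog} {m₀ m₁ m₂ : Mem} {s t : ℕ} :
      b.Holds m₀ → Exec p m₀ m₁ s → Exec (.while b p) m₁ m₂ t →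
      Exec (.while b p) m₀ m₂ (b.cost + s + t)
  | whileFalse {b : BExp} {p : Prog} {m : Mem} :
      ¬ b.Holds m → Exec (.while b p) m m b.cost

end RealRAM

namespace SparsePCA

/-- `‖A‖_{Fr, k²}`: the supremum of `⟨A, B⟩ = tr(Aᵀ B)` over the matrices `B` of Frobenius norm one
with at most `k²` non-zero entries. -/
noncomputable def sparseFrobNorm {d : ℕ} (k : ℕ) (A : Matrix (Fin d) (Fin d) ℝ) : ℝ :=
  sSup {c : ℝ | ∃ B : Matrix (Fin d) (Fin d) ℝ, ‖B‖ = 1 ∧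
    {p : Fin d × Fin d | B p.1 p.2 ≠ 0}.ncard ≤ k ^ 2 ∧ c = (A.transpose * B).trace}

/-- The empirical average of `g` over the finite set `S`. -/
noncomputable def avg {α : Type*} (S : Finset α) (g : α → ℝ) : ℝ :=
  (∑ x ∈ S, g x) / (S.card : ℝ)

/-- The empirical second moment matrix `E_S[x xᵀ]` (not centred). -/
noncomputable def secondMoment {d : ℕ} (S : Finset (EuclideanSpace ℝ (Fin d))) :
    Matrix (Fin d) (Fin d) ℝ :=
  Matrix.of fun i j => avg S fun x => x i * x j

/-- The principal submatrix `(A)_H`. -/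
def principal {d : ℕ} (H : Finset (Fin d)) (A : Matrix (Fin d) (Fin d) ℝ) : Matrix H H ℝ :=
  A.submatrix Subtype.val Subtype.val

/-- The rank-one matrix `v vᵀ`. -/
def outer {d : ℕ} (v : EuclideanSpace ℝ (Fin d)) : Matrix (Fin d) (Fin d) ℝ :=
  Matrix.of fun i j => v i * v j

/-- `(ε, δ)`-covariance stability with respect to `Sig` of the family of vectors `y x`, `x ∈ S`
(with multiplicity, as `y` may identify points): in isotropic position, the flattened second-moment
tensors are `(ε, δ)`-stable, that is, they have first moments within `δ` and second moments within
`δ² / ε` of those of the centred Gaussian with covariance `Sig`, in every unit direction and on every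
large subset.
For `g ∼ N(0, Sig)` and symmetric `B` the quadratic form `gᵀ B g` has mean `tr(B Sig)` and variance
`2 tr(B Sig B Sig)`. Writing `A = √2 Sig^{1/2} B Sig^{1/2}`, the forms of unit variance are those with
`‖A‖_Fr = 1`, and `yᵀ B y - tr(B Sig)` is the inner product of `A` with
`(Sig^{-1/2} y yᵀ Sig^{-1/2} - I) / √2`, so this is stability of the flattenings of the whitened
matrices `Sig^{-1/2} y yᵀ Sig^{-1/2}`, divided by `√2`, with respect to that of `I`. -/
def IsCovStable {α ι : Type*} [Fintype ι] (ε δ : ℝ) (S : Finset α) (y : α → ι → ℝ)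
    (Sig : Matrix ι ι ℝ) : Prop :=
  ∀ B : Matrix ι ι ℝ, B.IsSymm → 2 * (B * Sig * B * Sig).trace = 1 →
    ∀ S' ⊆ S, (1 - ε) * (S.card : ℝ) ≤ (S'.card : ℝ) →
      |avg S' fun x => y x ⬝ᵥ B.mulVec (y x) - (B * Sig).trace| ≤ δ ∧
      |(avg S' fun x => (y x ⬝ᵥ B.mulVec (y x) - (B * Sig).trace) ^ 2) - 1| ≤ δ ^ 2 / ε

/-- `S` is `(ε, γ, k, η)`-pca-stable with respect to the `k`-sparse unit vector `v` and the spike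
strength `η`. -/
structure IsPCAStable {d : ℕ} (S : Finset (EuclideanSpace ℝ (Fin d))) (ε γ : ℝ) (k : ℕ) (η : ℝ)
    (v : EuclideanSpace ℝ (Fin d)) : Prop where
  eps_pos : 0 < ε
  eps_lt : ε < 1 / 2
  eps_le : ε ≤ γ
  eta_nonneg : 0 ≤ η
  unit : ‖v‖ = 1
  sparse : {i : Fin d | v i ≠ 0}.ncard ≤ k
  second_moment : ∀ S' ⊆ S, (1 - ε) * (S.card : ℝ) ≤ (S'.card : ℝ) →
    sparseFrobNorm k (secondMoment S' - (1 + η • outer v)) ≤ γ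
  covariance : ∀ H : Finset (Fin d), H.card ≤ k →
    IsCovStable ε γ S (fun x (i : H) => x i) (principal H (1 + η • outer v))

open Classical in
/-- `T` is an `ε`-corrupted version of `S`: at most an `ε`-fraction of the points of `S` has been
replaced by other points. -/
def IsCorruption {d : ℕ} (ε : ℝ) (S T : Finset (EuclideanSpace ℝ (Fin d))) : Prop :=
  T.card = S.card ∧ (1 - ε) * (S.card : ℝ) ≤ ((S ∩ T).card : ℝ)

open Classical in
/-- The scores `f : T → ℝ₊` give the outliers at least the total score of the inliers, and their
maximum is positive. -/
def IsFilterScore {d : ℕ} (S T : Finset (EuclideanSpace ℝ (Fin d))) (f : T → ℝ) : Prop :=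
  (∀ x, 0 ≤ f x) ∧
  (∑ x ∈ T.attach with x.val ∈ S, f x ≤
    ∑ x ∈ T.attach with x.val ∉ S, f x) ∧
  ∃ x, 0 < f x

/-- The initial memory: array `0` of naturals holds `d, |T|, |H|`, array `1` of naturals lists the
elements of `H`, array `0` of reals holds the points of `T` as rows, array `1` of reals holds
`ε, γ, η` in its row `0`; all other cells are zero. -/
noncomputable def input {d : ℕ} {T : Finset (EuclideanSpace ℝ (Fin d))} {H : Finset (Fin d)}
    (eT : Fin T.card ≃ T) (eH : Fin H.card ≃ H) (ε γ η : ℝ) : RealRAM.Mem where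
  nat a i :=
    if a = 0 then (if i = 0 then d else if i = 1 then T.card else if i = 2 then H.card else 0)
    else if a = 1 then (if h : i < H.card then ((eH ⟨i, h⟩ : Fin d) : ℕ) else 0)
    else 0
  real a i j :=
    if a = 0 then
      (if h : i < T.card ∧ j < d then (eT ⟨i, h.1⟩ : EuclideanSpace ℝ (Fin d)) ⟨j, h.2⟩ else 0)
    else if a = 1 ∧ i = 0 then
      (if j = 0 then ε else if j = 1 then γ else if j = 2 then η else 0)
    else 0

/-- The scores that a computation leaves in column `0` of array `2` of reals, in the order in which
the points of `T` were listed. -/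
def output {d : ℕ} {T : Finset (EuclideanSpace ℝ (Fin d))} (eT : Fin T.card ≃ T)
    (m : RealRAM.Mem) : T → ℝ :=
  fun x => m.real 2 (eT.symm x) 0

end SparsePCA

/-!
The filter looks at the quadratic forms of the points restricted to `H`. Write `M` for the empirical
second moments of `T` on `H`, `Σ = (I + η v vᵀ)_H`, `A = M - Σ` and `a = ‖A‖`. The `excess` of a
symmetric matrix `B` is the empirical variance of the form `xᵀ B x` over `T`, minus the variance
`2 tr(B M B M)` that it has under a centred Gaussian with covariance `M`. It does not involve `v`.

The form `A` has large excess: the inliers have mean almost zero with respect to `Σ`, so that a mean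
of order `a²` over `T` comes from at most an `ε`-fraction of outliers, and by Cauchy–Schwarz their
second moment is of order `a⁴ / ε`. Replacing `Σ` by `M` in the variance and in the centring costs
only of order `(a + a²) a²`, which is negligible because `a` is a large multiple of `γ ≥ ε`
(`CorruptedPair.le_excess_momentError`). Conversely, stability says that a form of excess of order
`(a² / ε) ‖B‖²` owes it to the outliers, while an `ε`-fraction of the inliers carries a second moment
of order at most `γ² / ε + ε a²` times `‖B‖²` (`CorruptedPair.two_mul_sum_lt_sum_outliers`). Hence
the squared values of such a form, cut off after the `ε |T|` largest ones, are filter scores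
(`CorruptedPair.score`); the cut-off loses nothing on the outliers, as there are at most `ε |T|` of
them.

It remains to find a `B` of nearly maximal excess. The excess is the quadratic form of a self-adjoint
operator on matrices, and the shift by `2 ‖M‖²` makes it positive (`filterOp`). Power iteration from
all symmetric matrix units finds a Rayleigh quotient that is good enough after `|H|³ |T|` steps
(`exists_powerIterate`): the ratio of the shift to the excess is at most of order `|H| |T|`, as
there is an outlier and hence `1 ≤ ε |T|`. The analysis uses only that the moments `⟨x, Pⁱ x⟩` of a
positive operator are log-convex. Arithmetic is exact, so that no normalization is needed.

The program consists of `for` loops with the bounds `|H|` and `|T|` (`LoopProg`), and so its running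
time is polynomial for syntactic reasons (`LoopProg.exists_exec`). It reads only the coordinates in
`H`, whence the time does not depend on `d` at all.
-/

/-! ### Loop programs on the real RAM -/

namespace RealRAM

/-- Loop programs: the fragment of the real RAM in which every loop is a `for` loop.
`guarded b p` runs `p` if the test `b` holds, and `loop c b p` runs `p` with the values `0, 1, …` of
the counter in cell `0` of array `c`, up to entry `b` of array `0`. -/
inductive LoopProg : Type
  | setReal (a : ℕ) (i j : NExp) (e : RExp)
  | seq (p q : LoopProg)
  | guarded (b : BExp) (p : LoopProg)
  | loop (c b : ℕ) (p : LoopProg)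

namespace LoopProg

/-- Does the program write to the `x`-th array of naturals? -/
def writesNat : LoopProg → ℕ → Bool
  | setReal _ _ _ _, _ => false
  | seq p q, x => p.writesNat x || q.writesNat x
  | guarded _ p, x => p.writesNat x
  | loop c _ p, x => c == x || p.writesNat x

/-- Does the program write to the `x`-th array of reals? -/
def writesReal : LoopProg → ℕ → Bool
  | setReal a _ _ _, x => a == x
  | seq p q, x => p.writesReal x || q.writesReal x
  | guarded _ p, x => p.writesReal x
  | loop _ _ p, x => p.writesReal x

/-- Loop bounds are the entries `1` and `2` of array `0`, which is never written to, and the body of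
a loop does not touch its counter. -/
def wf : LoopProg → Bool
  | setReal _ _ _ _ => true
  | seq p q => p.wf && q.wf
  | guarded _ p => p.wf
  | loop c b p => p.wf && (b == 1 || b == 2) && !(c == 0) && !p.writesNat 0 && !p.writesNat c

/-- The translation to the real RAM: `loop c b p` runs `p` with the values `0, 1, …` of the counter
in cell `0` of array `c`, as long as it is below the entry `b` of array `0`. -/
def compile : LoopProg → Prog
  | setReal a i j e => .setReal a i j e
  | seq p q => .seq p.compile q.compile
  | guarded b p => .ite b p.compile .skip
  | loop c b p =>
      .seq (.setNat c (.lit 0) (.lit 0))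
        (.while (.natLT (.get c (.lit 0)) (.get 0 (.lit b)))
          (.seq p.compile (.setNat c (.lit 0) (.add (.get c (.lit 0)) (.lit 1)))))

open Classical in
/-- The memory that a loop program leaves. -/
noncomputable def run : LoopProg → Mem → Mem
  | setReal a i j e, m => m.setReal a (i.eval m) (j.eval m) (e.eval m)
  | seq p q, m => q.run (p.run m)
  | guarded b p, m => if b.Holds m then p.run m else m
  | loop c b p, m =>
      (fun m' => (p.run m').setNat c 0 ((p.run m').nat c 0 + 1))^[m.nat 0 b] (m.setNat c 0 0)

/-- The exponent in the running time: the nesting depth of the loops, crudely added up over sequential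
compositions. -/
def depth : LoopProg → ℕ
  | setReal _ _ _ _ => 0
  | seq p q => p.depth + q.depth
  | guarded _ p => p.depth
  | loop _ _ p => p.depth + 1

/-- The constant in the running time. Starting, testing and stepping the counter of a loop costs
`3 + 5 + (5 + 6) = 19` steps, up to the factor for the number of iterations. -/
def weight : LoopProg → ℕ
  | setReal _ i j e => i.cost + j.cost + e.cost + 1
  | seq p q => p.weight + q.weight
  | guarded b p => b.cost + p.weight + 1
  | loop _ _ p => p.weight + 19

/-- The memory `m'` differs from `m` only in arrays that `p` may write to. -/
structure Frame (p : LoopProg) (m m' : Mem) : Prop where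
  real : ∀ a, p.writesReal a = false → m'.real a = m.real a
  nat : ∀ a, p.writesNat a = false → m'.nat a = m.nat a

theorem Frame.refl (p : LoopProg) (m : Mem) : Frame p m m := ⟨fun _ _ => rfl, fun _ _ => rfl⟩

theorem Frame.trans {p : LoopProg} {m₁ m₂ m₃ : Mem} (h : Frame p m₁ m₂) (h' : Frame p m₂ m₃) :
    Frame p m₁ m₃ :=
  ⟨fun a ha => (h'.real a ha).trans (h.real a ha), fun a ha => (h'.nat a ha).trans (h.nat a ha)⟩

theorem Frame.mono {p q : LoopProg} {m m' : Mem} (h : Frame p m m')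
    (hR : ∀ a, q.writesReal a = false → p.writesReal a = false)
    (hN : ∀ a, q.writesNat a = false → p.writesNat a = false) : Frame q m m' :=
  ⟨fun a ha => h.real a (hR a ha), fun a ha => h.nat a (hN a ha)⟩

theorem Frame.setNat {c b : ℕ} {p : LoopProg} {m m' : Mem} (h : Frame (loop c b p) m m')
    (i x : ℕ) : Frame (loop c b p) m (m'.setNat c i x) := by
  refine ⟨fun a ha => h.real a ha, fun a ha => ?_⟩
  have hne : a ≠ c := by rintro rfl; simp [writesNat] at ha
  simpa [Mem.setNat, Function.update_of_ne hne] using h.nat a ha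

theorem Frame.of_body {c b : ℕ} {p : LoopProg} {m m' : Mem} (h : Frame p m m') :
    Frame (loop c b p) m m' :=
  h.mono (fun _ ha => ha) (fun _ ha => by simp [writesNat] at ha; exact ha.2)

theorem frame_run (p : LoopProg) (m : Mem) : Frame p m (p.run m) := by
  induction p generalizing m with
  | setReal a i j e =>
    refine ⟨fun x hx => ?_, fun _ _ => rfl⟩
    have hne : x ≠ a := by rintro rfl; simp [writesReal] at hx
    simp [run, Mem.setReal, Function.update_of_ne hne]
  | seq p q ihp ihq =>
    refine Frame.trans ((ihp m).mono ?_ ?_) ((ihq (p.run m)).mono ?_ ?_) <;>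
      intro a ha <;> simp [writesReal, writesNat] at ha <;> simp [ha]
  | guarded b p ih =>
    by_cases hb : b.Holds m
    · simpa [run, hb] using (ih m).mono (q := guarded b p) (fun _ ha => ha) (fun _ ha => ha)
    · simpa [run, hb] using Frame.refl _ m
  | loop c b p ih =>
    have key : ∀ k, Frame (loop c b p) m
        ((fun m' => (p.run m').setNat c 0 ((p.run m').nat c 0 + 1))^[k] (m.setNat c 0 0)) := by
      intro k
      induction k with
      | zero => exact (Frame.refl _ m).setNat 0 0
      | succ k ihk =>
        rw [Function.iterate_succ_apply']
        exact (ihk.trans (ih _).of_body).setNat _ _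
    exact key _

theorem nat_run {p : LoopProg} {a : ℕ} (h : p.writesNat a = false) (m : Mem) :
    (p.run m).nat a = m.nat a := (frame_run p m).nat a h

theorem writesNat_zero_of_wf {p : LoopProg} (hp : p.wf = true) : p.writesNat 0 = false := by
  induction p with
  | setReal a i j e => rfl
  | seq p q ihp ihq =>
    simp only [wf, Bool.and_eq_true] at hp
    simp [writesNat, ihp hp.1, ihq hp.2]
  | guarded b p ih => exact ih hp
  | loop c b p ih =>
    simp only [wf, Bool.and_eq_true] at hp
    have h1 := hp.1.1.2
    have h2 := ih hp.1.1.1.1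
    simp_all [writesNat]

/-- The `while` loop in the translation of a `for` loop: the number of iterations that are left is
the gap between the counter and the bound. -/
theorem exists_exec_while {p : LoopProg} {c b K τ : ℕ} (hc : c ≠ 0)
    (h0 : p.writesNat 0 = false) (hcp : p.writesNat c = false) {r : ℕ → ℕ}
    (hp : ∀ m : Mem, m.nat 0 = r → ∃ t, Exec p.compile m (p.run m) t ∧ t ≤ τ)
    (hK : r b = K) (k : ℕ) (m : Mem) (hm : m.nat 0 = r) (hk : m.nat c 0 + k = K) :
    ∃ t, Exec (.while (.natLT (.get c (.lit 0)) (.get 0 (.lit b)))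
          (.seq p.compile (.setNat c (.lit 0) (.add (.get c (.lit 0)) (.lit 1))))) m
        ((fun m' => (p.run m').setNat c 0 ((p.run m').nat c 0 + 1))^[k] m) t ∧
      t ≤ 5 + k * (τ + 11) := by
  induction k generalizing m with
  | zero =>
    refine ⟨_, Exec.whileFalse ?_, by simp [BExp.cost, NExp.cost]⟩
    simp only [BExp.Holds, NExp.eval, hm, hK]
    omega
  | succ k ih =>
    obtain ⟨s, hs, hsτ⟩ := hp m hm
    have hn0 : ((p.run m).setNat c 0 ((p.run m).nat c 0 + 1)).nat 0 = r := by
      simp [Mem.setNat, Function.update_of_ne hc.symm, nat_run h0, hm]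
    obtain ⟨t, ht, htτ⟩ := ih _ hn0 (by
      simp only [Mem.setNat, Function.update_self, nat_run hcp]; omega)
    refine ⟨_, Exec.whileTrue ?_ (Exec.seq hs (Exec.setNat _ _ _ _)) ht, ?_⟩
    · simp only [BExp.Holds, NExp.eval, hm, hK]
      omega
    · simp only [BExp.cost, NExp.cost]
      nlinarith

/-- A well-formed loop program halts in the memory `run` after at most `weight * X ^ depth` steps,
where `X` bounds the ranges of its loops. -/
theorem exists_exec {p : LoopProg} (hp : p.wf = true) {X : ℕ} (hX : 1 ≤ X) {m : Mem}
    (h1 : m.nat 0 1 ≤ X) (h2 : m.nat 0 2 ≤ X) :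
    ∃ t, Exec p.compile m (p.run m) t ∧ t ≤ p.weight * X ^ p.depth := by
  induction p generalizing m with
  | setReal a i j e => exact ⟨_, Exec.setReal m a i j e, by simp [weight, depth]⟩
  | seq p q ihp ihq =>
    simp only [wf, Bool.and_eq_true] at hp
    obtain ⟨s, hs, hsX⟩ := ihp hp.1 h1 h2
    have hn := nat_run (writesNat_zero_of_wf hp.1) m
    obtain ⟨t, ht, htX⟩ := ihq hp.2 (m := p.run m) (by rwa [hn]) (by rwa [hn])
    refine ⟨s + t, Exec.seq hs ht, ?_⟩
    have hpow := Nat.pow_le_pow_right hX (Nat.le_add_right p.depth q.depth)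
    have hpow' := Nat.pow_le_pow_right hX (Nat.le_add_left q.depth p.depth)
    simp only [weight, depth, add_mul]
    exact add_le_add (hsX.trans (Nat.mul_le_mul_left _ hpow))
      (htX.trans (Nat.mul_le_mul_left _ hpow'))
  | guarded b p ih =>
    simp only [wf] at hp
    have hpow : 1 ≤ X ^ p.depth := Nat.one_le_pow _ _ hX
    by_cases hb : b.Holds m
    · obtain ⟨t, ht, htX⟩ := ih hp h1 h2
      refine ⟨b.cost + t, ?_, ?_⟩
      · simpa [run, compile, hb] using Exec.iteTrue hb ht
      · simp only [weight, depth]; nlinarith [Nat.zero_le b.cost]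
    · refine ⟨b.cost + 1, ?_, ?_⟩
      · simpa [run, compile, hb] using Exec.iteFalse hb (Exec.skip m)
      · simp only [weight, depth]; nlinarith [Nat.zero_le b.cost, Nat.zero_le p.weight]
  | loop c b p ih =>
    simp only [wf, Bool.and_eq_true, Bool.or_eq_true, beq_iff_eq, Bool.not_eq_true',
      beq_eq_false_iff_ne] at hp
    obtain ⟨⟨⟨⟨hw, hb⟩, hc⟩, h0⟩, hcp⟩ := hp
    have hm0 : (m.setNat c 0 0).nat 0 = m.nat 0 := by
      simp [Mem.setNat, Function.update_of_ne hc.symm]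
    obtain ⟨t, ht, htX⟩ := exists_exec_while (τ := p.weight * X ^ p.depth) hc h0 hcp
      (fun m' hm' => ih hw (m := m') (by rwa [hm']) (by rwa [hm'])) (rfl : m.nat 0 b = _)
      (m.nat 0 b) (m.setNat c 0 0) hm0 (by simp [Mem.setNat])
    refine ⟨_, Exec.seq (Exec.setNat _ _ _ _) ht, ?_⟩
    have hbX : m.nat 0 b ≤ X := by rcases hb with rfl | rfl <;> assumption
    have hpow : 1 ≤ X ^ p.depth := Nat.one_le_pow _ _ hX
    have := Nat.mul_le_mul_right (p.weight * X ^ p.depth + 11) hbX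
    have h3 : X ≤ X * X ^ p.depth := Nat.le_mul_of_pos_right X hpow
    simp only [weight, depth, NExp.cost, pow_succ]
    nlinarith

/-- The invariant rule for loops. -/
theorem loop_induction {p : LoopProg} {c b : ℕ} (hcp : p.writesNat c = false) {m : Mem}
    (I : ℕ → (ℕ → ℕ → ℕ → ℝ) → Prop) (h0 : I 0 m.real)
    (hs : ∀ i < m.nat 0 b, ∀ m' : Mem, Frame (loop c b p) m m' → m'.nat c 0 = i →
      I i m'.real → I (i + 1) (p.run m').real) :
    I (m.nat 0 b) ((loop c b p).run m).real := by
  have key : ∀ k ≤ m.nat 0 b,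
      let m' := (fun m' => (p.run m').setNat c 0 ((p.run m').nat c 0 + 1))^[k] (m.setNat c 0 0)
      Frame (loop c b p) m m' ∧ m'.nat c 0 = k ∧ I k m'.real := by
    intro k
    induction k with
    | zero => exact fun _ => ⟨(Frame.refl _ m).setNat 0 0, by simp [Mem.setNat], h0⟩
    | succ k ih =>
      intro hk
      obtain ⟨hF, hcnt, hI⟩ := ih (by omega)
      rw [Function.iterate_succ_apply']
      refine ⟨(hF.trans (frame_run p _).of_body).setNat _ _, ?_, hs k (by omega) _ hF hcnt hI⟩
      simp only [Mem.setNat, Function.update_self]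
      rw [nat_run hcp]
      exact congrArg (· + 1) hcnt
  exact (key _ le_rfl).2.2

/-- `p`, started in `m`, adds `w` to the cell `(i, j)` of array `a` and leaves the rest of that array
as it is. -/
def Adds (p : LoopProg) (m : Mem) (a i j : ℕ) (w : ℝ) : Prop :=
  ∀ x y, (p.run m).real a x y = m.real a x y + if x = i ∧ y = j then w else 0

/-- `p`, started in `m`, writes `v` to the cell `(i, j)` of array `a` and leaves the rest of that
array as it is. -/
def SetsCell (p : LoopProg) (m : Mem) (a i j : ℕ) (v : ℝ) : Prop :=
  ∀ x y, (p.run m).real a x y = if x = i ∧ y = j then v else m.real a x y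

/-- `p`, started in `m`, writes `val x y` to the cells `(x, y) ∈ D` of array `a` and leaves the rest
of that array as it is. -/
def Sets (p : LoopProg) (m : Mem) (a : ℕ) (D : ℕ → ℕ → Prop) (val : ℕ → ℕ → ℝ) : Prop :=
  ∀ x y, (D x y → (p.run m).real a x y = val x y) ∧
    (¬ D x y → (p.run m).real a x y = m.real a x y)

/-- The program `a[i][j] += e`. -/
def addReal (a : ℕ) (i j : NExp) (e : RExp) : LoopProg :=
  setReal a i j (.add (.get a i j) e)

theorem real_setReal (a i j : ℕ) (w : ℝ) (m : Mem) (x y : ℕ) :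
    (m.setReal a i j w).real a x y = if x = i ∧ y = j then w else m.real a x y := by
  by_cases hx : x = i
  · by_cases hy : y = j
    · simp [Mem.setReal, hx, hy]
    · subst hx; simp [Mem.setReal, hy]
  · simp [Mem.setReal, hx]

theorem adds_addReal {a : ℕ} {i j : NExp} {e : RExp} {m : Mem} {i' j' : ℕ} {w : ℝ}
    (hi : i.eval m = i') (hj : j.eval m = j') (he : e.eval m = w) :
    Adds (addReal a i j e) m a i' j' w := by
  intro x y
  simp only [addReal, run, RExp.eval, real_setReal, hi, hj, he]
  split_ifs with h
  · rw [h.1, h.2]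
  · simp

theorem adds_guarded {b : BExp} {p : LoopProg} {m : Mem} {a i j : ℕ} {w : ℝ} {P : Prop} [Decidable P]
    (hb : b.Holds m ↔ P) (h : Adds p m a i j w) :
    Adds (guarded b p) m a i j (if P then w else 0) := by
  intro x y
  by_cases hP : P
  · simpa [run, hb, hP] using h x y
  · simp [run, hb, hP]

theorem sum_range_eq_sum_equiv {κ : Type*} [Fintype κ] {K : ℕ} (e : Fin K ≃ κ) (w : κ → ℝ) :
    ∑ i ∈ Finset.range K, (if h : i < K then w (e ⟨i, h⟩) else 0) = ∑ x, w x := by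
  rw [Finset.sum_range, ← e.sum_comp]
  exact Finset.sum_congr rfl fun i _ => by simp

/-- A loop over the index set `κ`, numbered by `e`, whose body adds `w x` to a cell, adds `∑ x, w x`
to it. -/
theorem adds_loop {κ : Type*} [Fintype κ] {p : LoopProg} {c b : ℕ} (hcp : p.writesNat c = false)
    {m : Mem} {a i j K : ℕ} (hK : m.nat 0 b = K) (e : Fin K ≃ κ) (w : κ → ℝ)
    (hs : ∀ x, ∀ m' : Mem, Frame (loop c b p) m m' → m'.nat c 0 = e.symm x →
      Adds p m' a i j (w x)) :
    Adds (loop c b p) m a i j (∑ x, w x) := by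
  subst hK
  have := loop_induction (b := b) hcp (m := m) (fun k R => ∀ x y, R a x y = m.real a x y +
    if x = i ∧ y = j then
      ∑ l ∈ Finset.range k, (if h : l < m.nat 0 b then w (e ⟨l, h⟩) else 0) else 0)
    (by simp) (by
      intro l hl m' hF hc hI x y
      rw [hs (e ⟨l, hl⟩) m' hF (by simp [hc]) x y, hI, Finset.sum_range_succ]
      split_ifs with h
      · ring
      · ring)
  rw [sum_range_eq_sum_equiv e w] at this
  exact this

theorem setsCell_setReal {a : ℕ} {i j : NExp} {e : RExp} {m : Mem} {i' j' : ℕ} {v : ℝ}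
    (hi : i.eval m = i') (hj : j.eval m = j') (he : e.eval m = v) :
    SetsCell (setReal a i j e) m a i' j' v := by
  intro x y
  simp only [run, real_setReal, hi, hj, he]

/-- Initialize a cell, then add to it. -/
theorem setsCell_seq_adds {p q : LoopProg} {m : Mem} {a i j : ℕ} {v w : ℝ}
    (hp : SetsCell p m a i j v) (hq : ∀ m', Frame p m m' → Adds q m' a i j w) :
    SetsCell (seq p q) m a i j (v + w) := by
  intro x y
  simp only [run]
  rw [hq _ (frame_run p m) x y, hp x y]
  split_ifs <;> simp

theorem adds_seq {p q : LoopProg} {m : Mem} {a i j : ℕ} {v w : ℝ}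
    (hp : Adds p m a i j v) (hq : ∀ m', Frame p m m' → Adds q m' a i j w) :
    Adds (seq p q) m a i j (v + w) := by
  intro x y
  simp only [run]
  rw [hq _ (frame_run p m) x y, hp x y]
  split_ifs <;> simp [add_assoc]

theorem SetsCell.sets {p : LoopProg} {m : Mem} {a i j : ℕ} {val : ℕ → ℕ → ℝ}
    (h : SetsCell p m a i j (val i j)) : Sets p m a (fun x y => x = i ∧ y = j) val := by
  intro x y
  rw [h x y]
  constructor
  · rintro ⟨rfl, rfl⟩; simp
  · intro hne; simp [hne]

theorem sets_loop {p : LoopProg} {c b : ℕ} (hcp : p.writesNat c = false) {m : Mem} {a K : ℕ}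
    {D : ℕ → ℕ → ℕ → Prop} {val : ℕ → ℕ → ℝ} (hK : m.nat 0 b = K)
    (hs : ∀ i < K, ∀ m' : Mem, Frame (loop c b p) m m' → m'.nat c 0 = i → Sets p m' a (D i) val) :
    Sets (loop c b p) m a (fun x y => ∃ i < K, D i x y) val := by
  subst hK
  refine loop_induction (b := b) hcp (m := m) (fun k R => ∀ x y,
    ((∃ i < k, D i x y) → R a x y = val x y) ∧ (¬ (∃ i < k, D i x y) → R a x y = m.real a x y))
    (by simp) ?_
  intro l hl m' hF hc hI x y
  have hx := hs l hl m' hF hc x y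
  by_cases hD : D l x y
  · exact ⟨fun _ => hx.1 hD, fun hne => absurd ⟨l, by omega, hD⟩ hne⟩
  · rw [hx.2 hD]
    constructor
    · rintro ⟨i, hi, hDi⟩
      refine (hI x y).1 ⟨i, ?_, hDi⟩
      rcases Nat.lt_succ_iff_lt_or_eq.1 hi with h | rfl
      · exact h
      · exact absurd hDi hD
    · rintro hne
      exact (hI x y).2 fun ⟨i, hi, hDi⟩ => hne ⟨i, by omega, hDi⟩

/-- A loop whose body applies `f` to the object that the memory represents by `R` applies the
iterates of `f`. -/
theorem loop_iterate {p : LoopProg} {c b : ℕ} (hcp : p.writesNat c = false) {m : Mem} {K : ℕ}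
    (hK : m.nat 0 b = K) {β : Type*} (R : (ℕ → ℕ → ℕ → ℝ) → β → Prop) (f : β → β) {x₀ : β}
    (h0 : R m.real x₀)
    (hs : ∀ (x : β) (m' : Mem), Frame (loop c b p) m m' → R m'.real x → R (p.run m').real (f x)) :
    R ((loop c b p).run m).real (f^[K] x₀) := by
  subst hK
  refine loop_induction (b := b) hcp (fun k r => R r (f^[k] x₀)) h0 ?_
  intro i _ m' hF _ hI
  rw [Function.iterate_succ_apply']
  exact hs _ m' hF hI

/-- A loop whose body writes the entry of index `x` fills a column. -/
theorem column_loop {κ : Type*} {p : LoopProg} {c b : ℕ} (hcp : p.writesNat c = false) {m : Mem}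
    {a j K : ℕ} (hK : m.nat 0 b = K) (e : Fin K ≃ κ) (v : κ → ℝ)
    (hs : ∀ x, ∀ m' : Mem, Frame (loop c b p) m m' → m'.nat c 0 = e.symm x →
      SetsCell p m' a (e.symm x) j (v x)) (x : κ) :
    ((loop c b p).run m).real a (e.symm x) j = v x := by
  have h := sets_loop (b := b) (a := a) (D := fun i x y => x = i ∧ y = j)
    (val := fun i _ => if h : i < K then v (e ⟨i, h⟩) else 0) hcp hK fun i hi m' hF hc => by
      have := hs (e ⟨i, hi⟩) m' hF (by simp [hc])
      refine SetsCell.sets ?_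
      simpa [hi] using this
  have h' := (h (e.symm x) j).1 ⟨_, (e.symm x).2, rfl, rfl⟩
  simpa using h'

/-- A double loop whose body writes the entry of index `(x, y)` fills a matrix. -/
theorem matrix_loop {κ : Type*} {p : LoopProg} {c c' b : ℕ} (hc : (loop c' b p).writesNat c = false)
    (hc' : p.writesNat c' = false) (h0 : (loop c b (loop c' b p)).writesNat 0 = false) {m : Mem}
    {a K : ℕ} (hK : m.nat 0 b = K) (e : Fin K ≃ κ) (v : κ → κ → ℝ)
    (hs : ∀ x y, ∀ m' : Mem, Frame (loop c b (loop c' b p)) m m' → m'.nat c 0 = e.symm x →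
      m'.nat c' 0 = e.symm y → SetsCell p m' a (e.symm x) (e.symm y) (v x y)) (x y : κ) :
    ((loop c b (loop c' b p)).run m).real a (e.symm x) (e.symm y) = v x y := by
  have h := sets_loop (b := b) (a := a) (D := fun i x y => ∃ j < K, x = i ∧ y = j)
    (val := fun i j => if h : i < K ∧ j < K then v (e ⟨i, h.1⟩) (e ⟨j, h.2⟩) else 0) hc hK
    fun i hi m' hF hci => by
      refine sets_loop (D := fun j x y => x = i ∧ y = j) hc' (by rw [hF.nat 0 h0, hK])
        fun j hj m'' hF' hcj => ?_
      have hi' : m''.nat c 0 = i := by rw [hF'.nat c hc, hci]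
      have := hs (e ⟨i, hi⟩) (e ⟨j, hj⟩) m'' (hF.trans hF'.of_body) (by simp [hi']) (by simp [hcj])
      refine SetsCell.sets ?_
      simpa [hi, hj] using this
  have h' := (h (e.symm x) (e.symm y)).1 ⟨_, (e.symm x).2, _, (e.symm y).2, rfl, rfl⟩
  simpa using h'

/-- A double loop whose body adds `w x y` to a cell adds the double sum to it. -/
theorem adds_loop_loop {κ : Type*} [Fintype κ] {p : LoopProg} {c c' b : ℕ}
    (hc : (loop c' b p).writesNat c = false)
    (hc' : p.writesNat c' = false) (h0 : (loop c b (loop c' b p)).writesNat 0 = false) {m : Mem}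
    {a i j K : ℕ} (hK : m.nat 0 b = K) (e : Fin K ≃ κ) (w : κ → κ → ℝ)
    (hs : ∀ x y, ∀ m' : Mem, Frame (loop c b (loop c' b p)) m m' → m'.nat c 0 = e.symm x →
      m'.nat c' 0 = e.symm y → Adds p m' a i j (w x y)) :
    Adds (loop c b (loop c' b p)) m a i j (∑ x, ∑ y, w x y) := by
  refine adds_loop hc hK e _ fun x m' hF hx => ?_
  refine adds_loop hc' (by rw [hF.nat 0 h0, hK]) e _ fun y m'' hF' hy => ?_
  exact hs x y m'' (hF.trans hF'.of_body) (by rw [hF'.nat c hc, hx]) hy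

end LoopProg
end RealRAM

/-! ### Power iteration and the Frobenius inner product -/

namespace SparsePCA

section PowerIteration

variable {V : Type*} [AddCommGroup V] [Module ℝ V] {β : LinearMap.BilinForm ℝ V} {P : V →ₗ[ℝ] V}

/-- The moments `⟨P ^ i x, x⟩` of a self-adjoint operator add up their exponents. -/
theorem apply_pow_apply_pow (hP : ∀ x y, β (P x) y = β x (P y)) (x y : V) (i j : ℕ) :
    β ((P ^ i) x) ((P ^ j) y) = β x ((P ^ (i + j)) y) := by
  induction i generalizing j with
  | zero => simp
  | succ i ih =>
    rw [pow_succ', Module.End.mul_apply, hP, ← Module.End.mul_apply, ← pow_succ', ih]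
    congr 3
    omega

theorem apply_pow_nonneg (hβ : ∀ x, 0 ≤ β x x) (hP : ∀ x y, β (P x) y = β x (P y))
    (hP0 : ∀ x, 0 ≤ β x (P x)) (x : V) (i : ℕ) : 0 ≤ β x ((P ^ i) x) := by
  rcases Nat.even_or_odd' i with ⟨k, rfl | rfl⟩
  · rw [two_mul, ← apply_pow_apply_pow hP]
    exact hβ _
  · have := hP0 ((P ^ k) x)
    rwa [← Module.End.mul_apply, ← pow_succ', apply_pow_apply_pow hP,
      show k + (k + 1) = 2 * k + 1 by ring] at this

/-- The moments of a positive operator are log-convex: the Cauchy–Schwarz inequality for the form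
`β` or for `⟨x, P y⟩`, according to the parity of the exponent. -/
theorem apply_pow_succ_sq_le (hs : LinearMap.IsSymm β) (hβ : ∀ x, 0 ≤ β x x)
    (hP : ∀ x y, β (P x) y = β x (P y)) (hP0 : ∀ x, 0 ≤ β x (P x)) (x : V) (i : ℕ) :
    β x ((P ^ (i + 1)) x) ^ 2 ≤ β x ((P ^ i) x) * β x ((P ^ (i + 2)) x) := by
  rcases Nat.even_or_odd' i with ⟨k, rfl | rfl⟩
  · have := β.apply_sq_le_of_symm hβ hs ((P ^ k) x) ((P ^ (k + 1)) x)
    simp only [apply_pow_apply_pow hP] at this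
    rwa [show k + (k + 1) = 2 * k + 1 by ring, ← two_mul,
      show k + 1 + (k + 1) = 2 * k + 2 by ring] at this
  · have := LinearMap.BilinForm.apply_sq_le_of_symm (β.compl₂ P) (fun x => by simpa using hP0 x)
      ⟨fun x y => by simpa [hP] using hs.eq x (P y)⟩ ((P ^ k) x) ((P ^ (k + 1)) x)
    simp only [LinearMap.compl₂_apply, ← Module.End.mul_apply, ← pow_succ',
      apply_pow_apply_pow hP] at this
    rwa [show k + (k + 1 + 1) = 2 * k + 1 + 1 by ring, show k + (k + 1) = 2 * k + 1 by ring,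
      show k + 1 + (k + 1 + 1) = 2 * k + 1 + 2 by ring] at this

/-- If the Rayleigh quotient of `x` is at least `ρ`, the moments of `x` grow at least at rate `ρ`. -/
theorem pow_mul_le_apply_pow (hs : LinearMap.IsSymm β) (hβ : ∀ x, 0 ≤ β x x)
    (hP : ∀ x y, β (P x) y = β x (P y)) (hP0 : ∀ x, 0 ≤ β x (P x)) {x : V} {ρ : ℝ} (hρ : 0 < ρ)
    (hx : 0 < β x x) (h : ρ * β x x ≤ β x (P x)) (i : ℕ) :
    ρ ^ i * β x x ≤ β x ((P ^ i) x) := by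
  have key : ∀ i, 0 < β x ((P ^ i) x) ∧ ρ * β x ((P ^ i) x) ≤ β x ((P ^ (i + 1)) x) := by
    intro i
    induction i with
    | zero => exact ⟨by simpa using hx, by simpa using h⟩
    | succ i ih =>
      have h1 : 0 < β x ((P ^ (i + 1)) x) := (mul_pos hρ ih.1).trans_le ih.2
      refine ⟨h1, le_of_mul_le_mul_left ?_ ih.1⟩
      have := apply_pow_succ_sq_le hs hβ hP hP0 x i
      nlinarith
  induction i with
  | zero => simp
  | succ i ih =>
    calc ρ ^ (i + 1) * β x x = ρ * (ρ ^ i * β x x) := by ring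
      _ ≤ ρ * β x ((P ^ i) x) := by gcongr
      _ ≤ _ := (key i).2

/-- If the Rayleigh quotient of the last iterate is at most `r`, the moments grew at most at rate
`r` all along. -/
theorem apply_pow_le_pow_mul (hs : LinearMap.IsSymm β) (hβ : ∀ x, 0 ≤ β x x)
    (hP : ∀ x y, β (P x) y = β x (P y)) (hP0 : ∀ x, 0 ≤ β x (P x)) {x : V} {r : ℝ} (hr : 0 ≤ r)
    (m : ℕ) (h : β x ((P ^ (m + 1)) x) ≤ r * β x ((P ^ m) x)) :
    β x ((P ^ m) x) ≤ r ^ m * β x x := by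
  induction m with
  | zero => simp
  | succ m ih =>
    have h0 := apply_pow_nonneg hβ hP hP0 x m
    have h1 := apply_pow_nonneg hβ hP hP0 x (m + 1)
    have h2 : β x ((P ^ (m + 1)) x) ≤ r * β x ((P ^ m) x) := by
      rcases h1.eq_or_lt with h1' | h1'
      · rw [← h1']; positivity
      · refine le_of_mul_le_mul_left ?_ h1'
        have := apply_pow_succ_sq_le hs hβ hP hP0 x m
        nlinarith
    calc β x ((P ^ (m + 1)) x) ≤ r * β x ((P ^ m) x) := h2
      _ ≤ r * (r ^ m * β x x) := by gcongr; exact ih h2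
      _ = _ := by ring

theorem apply_sum_smul_le (hs : LinearMap.IsSymm β) (hβ : ∀ x, 0 ≤ β x x) {J : Type*} [Fintype J]
    (c : J → ℝ) (y : J → V) :
    β (∑ j, c j • y j) (∑ j, c j • y j) ≤ (∑ j, c j ^ 2) * ∑ j, β (y j) (y j) := by
  set Y := ∑ j, c j • y j with hY
  have h1 : β Y Y = ∑ j, c j * β (y j) Y := by
    nth_rewrite 1 [hY]
    simp [LinearMap.sum_apply]
  have h2 : β Y Y ^ 2 ≤ (∑ j, c j ^ 2) * ∑ j, β (y j) Y ^ 2 := by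
    conv_lhs => rw [h1]
    exact Finset.sum_mul_sq_le_sq_mul_sq _ _ _
  have h3 : ∑ j, β (y j) Y ^ 2 ≤ (∑ j, β (y j) (y j)) * β Y Y := by
    rw [Finset.sum_mul]
    exact Finset.sum_le_sum fun j _ => β.apply_sq_le_of_symm hβ hs _ _
  have h4 : 0 ≤ ∑ j, c j ^ 2 := Finset.sum_nonneg fun _ _ => sq_nonneg _
  rcases (hβ Y).eq_or_lt with h | h
  · rw [← h]; exact mul_nonneg h4 (Finset.sum_nonneg fun _ _ => hβ _)
  · refine le_of_mul_le_mul_right ?_ h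
    nlinarith [mul_le_mul_of_nonneg_left h3 h4]

/-- Power iteration from several starting vectors `M j`: if a combination of them has Rayleigh
quotient at least `ρ`, then one of the iterates has Rayleigh quotient more than `r`. -/
theorem exists_lt_rayleigh_pow (hs : LinearMap.IsSymm β) (hβ : ∀ x, 0 ≤ β x x)
    (hP : ∀ x y, β (P x) y = β x (P y)) (hP0 : ∀ x, 0 ≤ β x (P x)) {J : Type*} [Fintype J]
    (M : J → V) (c : J → ℝ) {w : V} (hw : w = ∑ j, c j • M j) (hw0 : 0 < β w w) {D ρ r : ℝ}
    (hD : (∑ j, c j ^ 2) * ∑ j, β (M j) (M j) ≤ D * β w w) (hρ : 0 < ρ) (hr : 0 ≤ r)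
    (hρw : ρ * β w w ≤ β w (P w)) (L : ℕ) (hL : D * r ^ (2 * L) < ρ ^ (2 * L)) :
    ∃ j, r * β ((P ^ L) (M j)) ((P ^ L) (M j)) < β ((P ^ L) (M j)) (P ((P ^ L) (M j))) := by
  by_contra! hcon
  have hM : ∀ j, β (M j) ((P ^ (2 * L)) (M j)) ≤ r ^ (2 * L) * β (M j) (M j) := by
    intro j
    refine apply_pow_le_pow_mul hs hβ hP hP0 hr (2 * L) ?_
    have := hcon j
    rwa [← Module.End.mul_apply, ← pow_succ', apply_pow_apply_pow hP, apply_pow_apply_pow hP,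
      ← add_assoc, ← two_mul] at this
  have h1 := pow_mul_le_apply_pow hs hβ hP hP0 hρ hw0 hρw (2 * L)
  have h2 : β w ((P ^ (2 * L)) w) ≤ (∑ j, c j ^ 2) * ∑ j, β (M j) ((P ^ (2 * L)) (M j)) := by
    have := apply_sum_smul_le hs hβ c fun j => (P ^ L) (M j)
    simp only [← map_smul, ← map_sum, ← hw, apply_pow_apply_pow hP, ← two_mul] at this
    exact this
  have h3 : (∑ j, c j ^ 2) * ∑ j, β (M j) ((P ^ (2 * L)) (M j)) ≤
      (∑ j, c j ^ 2) * (r ^ (2 * L) * ∑ j, β (M j) (M j)) := by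
    rw [Finset.mul_sum (a := r ^ (2 * L))]
    exact mul_le_mul_of_nonneg_left (Finset.sum_le_sum fun j _ => hM j)
      (Finset.sum_nonneg fun _ _ => sq_nonneg _)
  have h4 := mul_le_mul_of_nonneg_left hD (pow_nonneg hr (2 * L))
  have h5 := mul_lt_mul_of_pos_right hL hw0
  nlinarith

end PowerIteration

section Frobenius

variable {ι : Type*} [Fintype ι]

/-- The Frobenius inner product `tr(Aᵀ B)`. -/
noncomputable def frobInner : LinearMap.BilinForm ℝ (Matrix ι ι ℝ) :=
  LinearMap.mk₂ ℝ (fun A B => (A.transpose * B).trace)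
    (fun A B C => by simp [Matrix.add_mul]) (fun c A B => by simp)
    (fun A B C => by simp [Matrix.mul_add]) (fun c A B => by simp)

theorem frobInner_eq_trace (A B : Matrix ι ι ℝ) : frobInner A B = (A.transpose * B).trace := rfl

theorem frobInner_eq_sum (A B : Matrix ι ι ℝ) : frobInner A B = ∑ i, ∑ j, A i j * B i j := by
  rw [frobInner_eq_trace, Finset.sum_comm]
  simp [Matrix.trace, Matrix.mul_apply]

theorem frobInner_isSymm : LinearMap.IsSymm (frobInner (ι := ι)) :=
  ⟨fun A B => by simp [frobInner_eq_sum, mul_comm]⟩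

theorem frobInner_comm (A B : Matrix ι ι ℝ) : frobInner A B = frobInner B A :=
  frobInner_isSymm.eq A B

theorem frobInner_self (A : Matrix ι ι ℝ) : frobInner A A = ‖A‖ ^ 2 := by
  have h : 0 ≤ ∑ i, ∑ j, A i j ^ 2 :=
    Finset.sum_nonneg fun _ _ => Finset.sum_nonneg fun _ _ => sq_nonneg _
  rw [Matrix.frobenius_norm_def, ← Real.sqrt_eq_rpow]
  simp only [Real.rpow_two, Real.norm_eq_abs, sq_abs]
  rw [Real.sq_sqrt h, frobInner_eq_sum]
  simp only [sq]

theorem frobInner_self_nonneg (A : Matrix ι ι ℝ) : 0 ≤ frobInner A A := by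
  rw [frobInner_self]; positivity

theorem abs_frobInner_le (A B : Matrix ι ι ℝ) : |frobInner A B| ≤ ‖A‖ * ‖B‖ := by
  refine abs_le_of_sq_le_sq ?_ (by positivity)
  have := frobInner.apply_sq_le_of_symm frobInner_self_nonneg frobInner_isSymm A B
  rwa [frobInner_self, frobInner_self, ← mul_pow] at this

theorem frobInner_single [DecidableEq ι] (p q : ι) (A : Matrix ι ι ℝ) :
    frobInner (Matrix.single p q 1) A = A p q := by
  simp [frobInner_eq_trace, Matrix.transpose_single, Matrix.trace_single_mul]

theorem norm_vecMulVec (u w : ι → ℝ) : ‖Matrix.vecMulVec u w‖ ^ 2 = (u ⬝ᵥ u) * (w ⬝ᵥ w) := by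
  rw [← frobInner_self, frobInner_eq_sum, dotProduct, dotProduct, Finset.sum_mul_sum]
  simp only [Matrix.vecMulVec_apply]
  exact Finset.sum_congr rfl fun _ _ => Finset.sum_congr rfl fun _ _ => by ring

theorem norm_mulVec_le (B : Matrix ι ι ℝ) (u : ι → ℝ) :
    B.mulVec u ⬝ᵥ B.mulVec u ≤ ‖B‖ ^ 2 * (u ⬝ᵥ u) := by
  rw [← frobInner_self, frobInner_eq_sum, dotProduct, Finset.sum_mul]
  refine Finset.sum_le_sum fun i _ => ?_
  have := Finset.sum_mul_sq_le_sq_mul_sq Finset.univ (B i) u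
  simpa [Matrix.mulVec, dotProduct, ← sq] using this

end Frobenius

end SparsePCA

/-! ### The filter operator -/

namespace SparsePCA

section FilterOperator

variable {τ ι : Type*} [Fintype τ]

/-- The second moment matrix of the family `Y`. -/
noncomputable def familyMoment (Y : τ → ι → ℝ) : Matrix ι ι ℝ :=
  Matrix.of fun p q => (∑ x, Y x p * Y x q) / Fintype.card τ

theorem familyMoment_isSymm (Y : τ → ι → ℝ) : (familyMoment Y).IsSymm := by
  ext p q
  simp [familyMoment, mul_comm]

/-- The deviation of `Y x (Y x)ᵀ` from its average. -/
noncomputable def deviation (Y : τ → ι → ℝ) (x : τ) : Matrix ι ι ℝ :=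
  Matrix.vecMulVec (Y x) (Y x) - familyMoment Y

theorem deviation_isSymm (Y : τ → ι → ℝ) (x : τ) : (deviation Y x).IsSymm := by
  have := familyMoment_isSymm Y
  ext p q
  simp [deviation, Matrix.vecMulVec_apply, mul_comm, this.apply p q]

variable [Fintype ι]

/-- The excess of the empirical variance of the quadratic form `B` over the variance that it has
under the centred Gaussian with the empirical second moments. -/
noncomputable def excess (Y : τ → ι → ℝ) (B : Matrix ι ι ℝ) : ℝ :=
  (∑ x, frobInner B (deviation Y x) ^ 2) / Fintype.card τ -
    2 * frobInner B (familyMoment Y * B * familyMoment Y)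

/-- The operator of the quadratic form `excess`, shifted by a multiple of the identity that makes it
positive. -/
noncomputable def filterOp (Y : τ → ι → ℝ) : Matrix ι ι ℝ →ₗ[ℝ] Matrix ι ι ℝ :=
  (2 * ‖familyMoment Y‖ ^ 2) • LinearMap.id +
    (Fintype.card τ : ℝ)⁻¹ •
      (∑ x, (LinearMap.flip frobInner (deviation Y x)).smulRight (deviation Y x)) -
    (2 : ℝ) • (LinearMap.mulLeft ℝ (familyMoment Y) ∘ₗ LinearMap.mulRight ℝ (familyMoment Y))

theorem filterOp_apply (Y : τ → ι → ℝ) (B : Matrix ι ι ℝ) :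
    filterOp Y B = (2 * ‖familyMoment Y‖ ^ 2) • B +
      (Fintype.card τ : ℝ)⁻¹ • (∑ x, frobInner B (deviation Y x) • deviation Y x) -
      (2 : ℝ) • (familyMoment Y * B * familyMoment Y) := by
  simp [filterOp, LinearMap.sum_apply, mul_assoc]

theorem frobInner_conj (S A B : Matrix ι ι ℝ) (hS : S.IsSymm) :
    frobInner (S * A * S) B = frobInner A (S * B * S) := by
  have hS' : S.transpose = S := hS
  simp only [frobInner_eq_trace, Matrix.transpose_mul, hS']
  rw [Matrix.mul_assoc S, Matrix.mul_assoc S, Matrix.trace_mul_comm S]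
  simp only [Matrix.mul_assoc]

theorem frobInner_filterOp (Y : τ → ι → ℝ) (A B : Matrix ι ι ℝ) :
    frobInner A (filterOp Y B) = 2 * ‖familyMoment Y‖ ^ 2 * frobInner A B +
      (Fintype.card τ : ℝ)⁻¹ *
        (∑ x, frobInner A (deviation Y x) * frobInner B (deviation Y x)) -
      2 * frobInner A (familyMoment Y * B * familyMoment Y) := by
  simp [filterOp_apply, map_sum, mul_comm]

theorem frobInner_self_filterOp (Y : τ → ι → ℝ) (B : Matrix ι ι ℝ) :
    frobInner B (filterOp Y B) = excess Y B + 2 * ‖familyMoment Y‖ ^ 2 * ‖B‖ ^ 2 := by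
  rw [frobInner_filterOp, frobInner_self, excess]
  simp only [← sq]
  ring

theorem filterOp_selfAdjoint (Y : τ → ι → ℝ) (A B : Matrix ι ι ℝ) :
    frobInner (filterOp Y A) B = frobInner A (filterOp Y B) := by
  rw [frobInner_comm, frobInner_filterOp, frobInner_filterOp, frobInner_comm B A,
    ← frobInner_conj _ B A (familyMoment_isSymm Y),
    frobInner_comm (familyMoment Y * B * familyMoment Y)]
  simp only [mul_comm (frobInner B _)]

theorem filterOp_nonneg (Y : τ → ι → ℝ) (B : Matrix ι ι ℝ) :
    0 ≤ frobInner B (filterOp Y B) := by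
  rw [frobInner_filterOp, frobInner_self]
  have h1 := (abs_le.1 (abs_frobInner_le B (familyMoment Y * B * familyMoment Y))).2
  have h2 : ‖familyMoment Y * B * familyMoment Y‖ ≤ ‖familyMoment Y‖ * ‖B‖ * ‖familyMoment Y‖ :=
    (Matrix.frobenius_norm_mul _ _).trans
      (mul_le_mul_of_nonneg_right (Matrix.frobenius_norm_mul _ _) (norm_nonneg _))
  have h3 := mul_le_mul_of_nonneg_left h2 (norm_nonneg B)
  have h4 : 0 ≤ (Fintype.card τ : ℝ)⁻¹ *
      (∑ x, frobInner B (deviation Y x) * frobInner B (deviation Y x)) :=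
    mul_nonneg (by positivity) (Finset.sum_nonneg fun _ _ => mul_self_nonneg _)
  nlinarith

theorem filterOp_isSymm (Y : τ → ι → ℝ) {B : Matrix ι ι ℝ} (hB : B.IsSymm) :
    (filterOp Y B).IsSymm := by
  have hS : (familyMoment Y).transpose = familyMoment Y := familyMoment_isSymm Y
  have hB' : B.transpose = B := hB
  have hD : ∀ x, (deviation Y x).transpose = deviation Y x := deviation_isSymm Y
  unfold Matrix.IsSymm
  simp [filterOp_apply, Matrix.transpose_mul, hS, hB', hD, Matrix.transpose_sum, Matrix.mul_assoc]

/-- The symmetric matrix units from which the power iteration starts. -/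
def symmUnit [DecidableEq ι] (p q : ι) : Matrix ι ι ℝ :=
  Matrix.single p q 1 + Matrix.single q p 1

/-- The iterates of the filter operator on a symmetric matrix unit. -/
noncomputable def powerIterate [DecidableEq ι] (Y : τ → ι → ℝ) (L : ℕ) (p q : ι) : Matrix ι ι ℝ :=
  (filterOp Y)^[L] (symmUnit p q)

theorem powerIterate_isSymm [DecidableEq ι] (Y : τ → ι → ℝ) (L : ℕ) (p q : ι) :
    (powerIterate Y L p q).IsSymm := by
  induction L with
  | zero => simp [powerIterate, symmUnit, Matrix.IsSymm, add_comm, Matrix.transpose_single]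
  | succ L ih =>
    rw [powerIterate, Function.iterate_succ_apply']
    exact filterOp_isSymm Y ih

theorem sum_smul_symmUnit [DecidableEq ι] {w : Matrix ι ι ℝ} (hw : w.IsSymm) :
    w = ∑ j : ι × ι, (w j.1 j.2 / 2) • symmUnit j.1 j.2 := by
  ext x y
  simp only [symmUnit, Fintype.sum_prod_type, Matrix.sum_apply, Matrix.smul_apply,
    Matrix.add_apply, smul_add, Matrix.single_apply, Finset.sum_add_distrib]
  simp [ite_and, hw.apply x y]

/-- If some symmetric `w` has excess at least `lam ‖w‖²`, then one of the power iterates has at least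
half of that. The exponent beats the dimension because of Bernoulli's inequality. -/
theorem exists_powerIterate [DecidableEq ι] (Y : τ → ι → ℝ) {w : Matrix ι ι ℝ} (hw : w.IsSymm)
    (hw0 : w ≠ 0) {lam : ℝ} (hlam : 0 < lam) (hex : lam * ‖w‖ ^ 2 ≤ excess Y w) (L : ℕ)
    (hL : (Fintype.card ι : ℝ) ^ 2 * (2 * (2 * ‖familyMoment Y‖ ^ 2) + lam) ≤ 2 * L * lam) :
    ∃ p q, (2 * ‖familyMoment Y‖ ^ 2 + lam / 2) * ‖powerIterate Y L p q‖ ^ 2 <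
      frobInner (powerIterate Y L p q) (filterOp Y (powerIterate Y L p q)) := by
  set s := 2 * ‖familyMoment Y‖ ^ 2 with hs
  have hs0 : 0 ≤ s := by positivity
  have hwpos : 0 < ‖w‖ := norm_pos_iff.2 hw0
  -- The coefficients `w j / 2` of `w` have square sum `‖w‖² / 4`, and the starting vectors have
  -- squared norm at most `4`, so that only the dimension is lost.
  have hM : ∀ j : ι × ι, frobInner (symmUnit j.1 j.2) (symmUnit j.1 j.2) ≤ 4 := by
    rintro ⟨p, q⟩
    have : symmUnit p q p q + symmUnit p q q p ≤ (4 : ℝ) := by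
      simp only [symmUnit, Matrix.add_apply, Matrix.single_apply]
      split_ifs <;> norm_num
    conv_lhs => enter [1]; simp only [symmUnit]
    simpa [frobInner_single] using this
  have hD : (∑ j : ι × ι, (w j.1 j.2 / 2) ^ 2) *
      ∑ j : ι × ι, frobInner (symmUnit j.1 j.2) (symmUnit j.1 j.2) ≤
      (Fintype.card ι : ℝ) ^ 2 * frobInner w w := by
    have h1 : ∑ j : ι × ι, (w j.1 j.2 / 2) ^ 2 = frobInner w w / 4 := by
      rw [frobInner_eq_sum, Fintype.sum_prod_type, Finset.sum_div]
      refine Finset.sum_congr rfl fun _ _ => ?_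
      rw [Finset.sum_div]
      exact Finset.sum_congr rfl fun _ _ => by ring
    have h2 : ∑ j : ι × ι, frobInner (symmUnit j.1 j.2) (symmUnit j.1 j.2) ≤
        (Fintype.card ι : ℝ) ^ 2 * 4 := by
      refine (Finset.sum_le_sum fun j _ => hM j).trans_eq ?_
      simp [sq]
    rw [h1]
    nlinarith [mul_le_mul_of_nonneg_left h2 (frobInner_self_nonneg w)]
  have hpow : (Fintype.card ι : ℝ) ^ 2 * (s + lam / 2) ^ (2 * L) < (s + lam) ^ (2 * L) := by
    have hr : 0 < s + lam / 2 := by positivity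
    have hx : s + lam = (s + lam / 2) * (1 + lam / 2 / (s + lam / 2)) := by
      field_simp
      ring
    rw [hx, mul_pow, mul_comm]
    refine mul_lt_mul_of_pos_left ?_ (by positivity)
    have hb := one_add_mul_le_pow (a := lam / 2 / (s + lam / 2))
      (by have : 0 ≤ lam / 2 / (s + lam / 2) := by positivity
          linarith) (2 * L)
    refine lt_of_lt_of_le ?_ hb
    have : (Fintype.card ι : ℝ) ^ 2 ≤ ((2 * L : ℕ) : ℝ) * (lam / 2 / (s + lam / 2)) := by
      rw [← mul_div_assoc, le_div_iff₀ hr]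
      push_cast
      nlinarith
    linarith
  obtain ⟨j, hj⟩ := exists_lt_rayleigh_pow (P := filterOp Y) frobInner_isSymm frobInner_self_nonneg
    (filterOp_selfAdjoint Y) (filterOp_nonneg Y) (fun j : ι × ι => symmUnit j.1 j.2)
    (fun j => w j.1 j.2 / 2) (sum_smul_symmUnit hw) (by rw [frobInner_self]; positivity) hD
    (by positivity) (by positivity : 0 ≤ s + lam / 2)
    (by rw [frobInner_self_filterOp, frobInner_self]; nlinarith) L hpow
  refine ⟨j.1, j.2, ?_⟩
  rw [← frobInner_self]
  simpa [powerIterate, Module.End.coe_pow] using hj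

end FilterOperator

end SparsePCA

/-! ### Quadratic forms under a spiked covariance -/

namespace SparsePCA

section Spiked

variable {ι : Type*} [Fintype ι] [DecidableEq ι]

omit [DecidableEq ι] in
theorem abs_trace_mul_le (A B : Matrix ι ι ℝ) : |(A * B).trace| ≤ ‖A‖ * ‖B‖ := by
  have := abs_frobInner_le A.transpose B
  rwa [frobInner_eq_trace, Matrix.transpose_transpose, Matrix.frobenius_norm_transpose] at this

omit [DecidableEq ι] in
theorem vecMul_eq_mulVec {B : Matrix ι ι ℝ} (hB : B.IsSymm) (u : ι → ℝ) :
    Matrix.vecMul u B = B.mulVec u := by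
  have hB' : B.transpose = B := hB
  rw [← Matrix.mulVec_transpose, hB']

omit [DecidableEq ι] in
theorem dotProduct_mulVec_self_le {B : Matrix ι ι ℝ} {u : ι → ℝ} (hu : u ⬝ᵥ u ≤ 1) :
    B.mulVec u ⬝ᵥ B.mulVec u ≤ ‖B‖ ^ 2 := by
  have := norm_mulVec_le B u
  nlinarith [sq_nonneg ‖B‖]

theorem mul_spiked {B Sig : Matrix ι ι ℝ} {u : ι → ℝ} {η : ℝ}
    (hSig : Sig = 1 + η • Matrix.vecMulVec u u) :
    B * Sig = B + η • Matrix.vecMulVec (B.mulVec u) u := by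
  rw [hSig, Matrix.mul_add, Matrix.mul_one, Matrix.mul_smul, Matrix.mul_vecMulVec]

/-- The spiked covariance `1 + η u uᵀ` distorts the Frobenius norm by a factor of at most four. -/
theorem trace_spiked_bounds {B : Matrix ι ι ℝ} (hB : B.IsSymm) {u : ι → ℝ} {η : ℝ} (h0 : 0 ≤ η)
    (h1 : η ≤ 1) (hu : u ⬝ᵥ u ≤ 1) {Sig : Matrix ι ι ℝ}
    (hSig : Sig = 1 + η • Matrix.vecMulVec u u) :
    ‖B‖ ^ 2 ≤ (B * Sig * B * Sig).trace ∧ (B * Sig * B * Sig).trace ≤ 4 * ‖B‖ ^ 2 := by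
  have hB' : B.transpose = B := hB
  have hBS := mul_spiked (B := B) hSig
  have hww := dotProduct_mulVec_self_le (B := B) hu
  set w := B.mulVec u with hw
  have hww0 : 0 ≤ w ⬝ᵥ w := Finset.sum_nonneg fun _ _ => mul_self_nonneg _
  have hu0 : 0 ≤ u ⬝ᵥ u := Finset.sum_nonneg fun _ _ => mul_self_nonneg _
  have huw : (u ⬝ᵥ w) ^ 2 ≤ ‖B‖ ^ 2 := by
    have : (u ⬝ᵥ w) ^ 2 ≤ (u ⬝ᵥ u) * (w ⬝ᵥ w) := by
      have := Finset.sum_mul_sq_le_sq_mul_sq Finset.univ u w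
      simpa [dotProduct, ← sq] using this
    nlinarith
  have htr : (B * Sig * B * Sig).trace = ‖B‖ ^ 2 + 2 * η * (w ⬝ᵥ w) + η ^ 2 * (u ⬝ᵥ w) ^ 2 := by
    have e1 : (B * B).trace = ‖B‖ ^ 2 := by
      rw [← frobInner_self, frobInner_eq_trace, hB']
    have e2 : (B * Matrix.vecMulVec w u).trace = w ⬝ᵥ w := by
      rw [Matrix.mul_vecMulVec, Matrix.trace_vecMulVec, dotProduct_comm, Matrix.dotProduct_mulVec,
        vecMul_eq_mulVec hB]
    have e3 : (Matrix.vecMulVec w u * Matrix.vecMulVec w u).trace = (u ⬝ᵥ w) ^ 2 := by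
      rw [Matrix.mul_vecMulVec, Matrix.trace_vecMulVec, Matrix.vecMulVec_mulVec]
      simp [dotProduct_comm w u, sq]
    rw [Matrix.mul_assoc (B * Sig), hBS]
    simp only [Matrix.add_mul, Matrix.mul_add, Matrix.smul_mul, Matrix.mul_smul, Matrix.trace_add,
      Matrix.trace_smul, smul_eq_mul, Matrix.trace_mul_comm (Matrix.vecMulVec w u) B, e1, e2, e3]
    ring
  rw [htr]
  have hη2 : η ^ 2 ≤ 1 := by nlinarith
  constructor
  · have := mul_nonneg (sq_nonneg η) (sq_nonneg (u ⬝ᵥ w))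
    have := mul_nonneg h0 hww0
    nlinarith
  · have := mul_le_mul hη2 huw (sq_nonneg _) zero_le_one
    have := mul_le_mul h1 hww hww0 zero_le_one
    nlinarith

/-- The Gaussian variance of a quadratic form depends continuously on the covariance. -/
theorem abs_trace_sub_trace_spiked_le {B : Matrix ι ι ℝ} (hB : B.IsSymm) {u : ι → ℝ} {η : ℝ}
    (h0 : 0 ≤ η) (h1 : η ≤ 1) (hu : u ⬝ᵥ u ≤ 1) {Sig : Matrix ι ι ℝ}
    (hSig : Sig = 1 + η • Matrix.vecMulVec u u) (A : Matrix ι ι ℝ) :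
    |(B * (Sig + A) * B * (Sig + A)).trace - (B * Sig * B * Sig).trace| ≤
      (4 * ‖A‖ + ‖A‖ ^ 2) * ‖B‖ ^ 2 := by
  have hexp : (B * (Sig + A) * B * (Sig + A)).trace - (B * Sig * B * Sig).trace =
      2 * (B * Sig * B * A).trace + (B * A * (B * A)).trace := by
    have : (B * A * (B * Sig)).trace = (B * Sig * (B * A)).trace := Matrix.trace_mul_comm _ _
    simp only [Matrix.mul_add, Matrix.add_mul, Matrix.trace_add, ← Matrix.mul_assoc] at this ⊢
    linarith
  have hw := dotProduct_mulVec_self_le (B := B) hu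
  have hBSB : ‖B * Sig * B‖ ≤ 2 * ‖B‖ ^ 2 := by
    rw [mul_spiked hSig, Matrix.add_mul, Matrix.smul_mul, Matrix.vecMulVec_mul,
      vecMul_eq_mulVec hB]
    have e1 : ‖B * B‖ ≤ ‖B‖ ^ 2 := by
      simpa [sq] using Matrix.frobenius_norm_mul B B
    have e2 : ‖Matrix.vecMulVec (B.mulVec u) (B.mulVec u)‖ ≤ ‖B‖ ^ 2 := by
      refine le_trans (abs_le_of_sq_le_sq' ?_ ?_).2 hw
      · rw [norm_vecMulVec, sq]
      · exact Finset.sum_nonneg fun _ _ => mul_self_nonneg _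
    have e3 : ‖η • Matrix.vecMulVec (B.mulVec u) (B.mulVec u)‖ ≤ ‖B‖ ^ 2 := by
      have : ‖η • Matrix.vecMulVec (B.mulVec u) (B.mulVec u)‖ =
          η * ‖Matrix.vecMulVec (B.mulVec u) (B.mulVec u)‖ := by
        refine (sq_eq_sq₀ (norm_nonneg _) (by positivity)).1 ?_
        rw [mul_pow, ← frobInner_self, ← frobInner_self]
        simp
        ring
      rw [this]
      nlinarith [norm_nonneg (Matrix.vecMulVec (B.mulVec u) (B.mulVec u))]
    linarith [norm_add_le (B * B) (η • Matrix.vecMulVec (B.mulVec u) (B.mulVec u))]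
  have h2 := abs_trace_mul_le (B * Sig * B) A
  have h3 := abs_trace_mul_le (B * A) (B * A)
  have h4 : ‖B * A‖ ≤ ‖B‖ * ‖A‖ := Matrix.frobenius_norm_mul B A
  have h5 : ‖B * A‖ * ‖B * A‖ ≤ ‖B‖ * ‖A‖ * (‖B‖ * ‖A‖) := by gcongr
  have h6 : ‖B * Sig * B‖ * ‖A‖ ≤ 2 * ‖B‖ ^ 2 * ‖A‖ := by gcongr
  rw [hexp]
  refine (abs_add_le _ _).trans ?_
  rw [abs_mul, abs_two]
  nlinarith

end Spiked
end SparsePCA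

/-! ### Quadratic forms on a corrupted stable set -/

namespace SparsePCA

section Corruption

variable {α ι : Type*} [Fintype ι]

/-- The quadratic form `B`, centred according to the covariance `Sig`. -/
noncomputable def centredForm (y : α → ι → ℝ) (Sig B : Matrix ι ι ℝ) (x : α) : ℝ :=
  y x ⬝ᵥ B.mulVec (y x) - (B * Sig).trace

theorem centredForm_smul (y : α → ι → ℝ) (Sig B : Matrix ι ι ℝ) (c : ℝ) (x : α) :
    centredForm y Sig (c • B) x = c * centredForm y Sig B x := by
  simp [centredForm, Matrix.smul_mulVec, mul_sub]

theorem avg_mul_card {S : Finset α} (g : α → ℝ) : avg S g * S.card = ∑ x ∈ S, g x := by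
  rcases S.eq_empty_or_nonempty with rfl | h
  · simp
  · have : (S.card : ℝ) ≠ 0 := by exact_mod_cast h.card_pos.ne'
    rw [avg, div_mul_cancel₀ _ this]

/-- Covariance stability without the normalization of the variance and with sums in place of
averages. -/
theorem IsCovStable.sum_bounds {ε γ : ℝ} {S : Finset α} {y : α → ι → ℝ} {Sig : Matrix ι ι ℝ}
    (hS : IsCovStable ε γ S y Sig) {B : Matrix ι ι ℝ} (hB : B.IsSymm) {b : ℝ} (hb : 0 < b)
    (hbB : 2 * (B * Sig * B * Sig).trace = b ^ 2) {S' : Finset α} (hS' : S' ⊆ S)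
    (hcard : (1 - ε) * (S.card : ℝ) ≤ (S'.card : ℝ)) :
    |∑ x ∈ S', centredForm y Sig B x| ≤ γ * b * S'.card ∧
    |∑ x ∈ S', centredForm y Sig B x ^ 2 - b ^ 2 * S'.card| ≤ b ^ 2 * (γ ^ 2 / ε) * S'.card := by
  have hB' : (b⁻¹ • B).IsSymm := by
    unfold Matrix.IsSymm
    rw [Matrix.transpose_smul, hB]
  have hn : 2 * (b⁻¹ • B * Sig * (b⁻¹ • B) * Sig).trace = 1 := by
    simp only [Matrix.smul_mul, Matrix.mul_smul, Matrix.trace_smul, smul_eq_mul]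
    field_simp
    linarith
  obtain ⟨h1, h2⟩ := hS _ hB' hn S' hS' hcard
  have hc : (0 : ℝ) ≤ S'.card := Nat.cast_nonneg _
  have e1 : ∑ x ∈ S', centredForm y Sig B x =
      b * ((avg S' fun x => centredForm y Sig (b⁻¹ • B) x) * S'.card) := by
    rw [avg_mul_card, Finset.mul_sum]
    exact Finset.sum_congr rfl fun x _ => by rw [centredForm_smul]; field_simp
  have e2 : ∑ x ∈ S', centredForm y Sig B x ^ 2 =
      b ^ 2 * ((avg S' fun x => centredForm y Sig (b⁻¹ • B) x ^ 2) * S'.card) := by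
    rw [avg_mul_card, Finset.mul_sum]
    exact Finset.sum_congr rfl fun x _ => by rw [centredForm_smul]; field_simp
  constructor
  · rw [e1, abs_mul, abs_mul, abs_of_pos hb, abs_of_nonneg hc]
    have := mul_le_mul_of_nonneg_left (mul_le_mul_of_nonneg_right h1 hc) hb.le
    calc _ ≤ _ := this
      _ = _ := by ring
  · have e3 : b ^ 2 * ((avg S' fun x => centredForm y Sig (b⁻¹ • B) x ^ 2) * S'.card) -
        b ^ 2 * S'.card = b ^ 2 * (((avg S' fun x => centredForm y Sig (b⁻¹ • B) x ^ 2) - 1) *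
          S'.card) := by ring
    rw [e2, e3, abs_mul, abs_mul, abs_of_pos (by positivity : 0 < b ^ 2), abs_of_nonneg hc]
    have := mul_le_mul_of_nonneg_left (mul_le_mul_of_nonneg_right h2 hc) (sq_nonneg b)
    calc _ ≤ _ := this
      _ = _ := by ring

/-- Small subsets of a stable set carry little of the second moment of a quadratic form: compare the
whole set with the complement. -/
theorem IsCovStable.sum_sq_le_of_card_le {ε γ : ℝ} (hε : 0 < ε) (hγ : ε ≤ γ) {S : Finset α}
    {y : α → ι → ℝ} {Sig : Matrix ι ι ℝ} (hS : IsCovStable ε γ S y Sig) {B : Matrix ι ι ℝ}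
    (hB : B.IsSymm) {b : ℝ} (hb : 0 < b) (hbB : 2 * (B * Sig * B * Sig).trace = b ^ 2)
    {L : Finset α} (hL : L ⊆ S) (hcard : (L.card : ℝ) ≤ ε * S.card) :
    ∑ x ∈ L, centredForm y Sig B x ^ 2 ≤ S.card * (3 * b ^ 2 * (γ ^ 2 / ε)) := by
  classical
  have hn : (0 : ℝ) ≤ S.card := Nat.cast_nonneg _
  have hc : ((S \ L).card : ℝ) = S.card - L.card := by
    rw [Finset.card_sdiff_of_subset hL, Nat.cast_sub (Finset.card_le_card hL)]
  have h1 := (abs_le.1 (hS.sum_bounds hB hb hbB subset_rfl (by nlinarith)).2).2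
  have h2 := (abs_le.1 (hS.sum_bounds hB hb hbB (S' := S \ L) Finset.sdiff_subset
    (by rw [hc]; linarith)).2).1
  have h3 := Finset.sum_sdiff hL (f := fun x => centredForm y Sig B x ^ 2)
  have h4 : ε ≤ γ ^ 2 / ε := by
    rw [le_div_iff₀ hε]; nlinarith
  have h5 : (0 : ℝ) ≤ L.card := Nat.cast_nonneg _
  have hb2 : 0 < b ^ 2 := by positivity
  have h6 : b ^ 2 * (γ ^ 2 / ε) * (S \ L).card ≤ b ^ 2 * (γ ^ 2 / ε) * S.card := by
    rw [hc]
    have : 0 ≤ b ^ 2 * (γ ^ 2 / ε) := by positivity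
    nlinarith
  have h7 : b ^ 2 * L.card ≤ b ^ 2 * ((γ ^ 2 / ε) * S.card) := by
    have := mul_le_mul_of_nonneg_right h4 hn
    have : (L.card : ℝ) ≤ γ ^ 2 / ε * S.card := by linarith
    gcongr
  rw [hc] at h2 h6
  nlinarith

theorem frobInner_vecMulVec {B : Matrix ι ι ℝ} (hB : B.IsSymm) (u : ι → ℝ) :
    frobInner B (Matrix.vecMulVec u u) = u ⬝ᵥ B.mulVec u := by
  have hB' : B.transpose = B := hB
  rw [frobInner_eq_trace, hB', Matrix.mul_vecMulVec, Matrix.trace_vecMulVec, dotProduct_comm]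

theorem frobInner_eq_trace_mul {B : Matrix ι ι ℝ} (hB : B.IsSymm) (A : Matrix ι ι ℝ) :
    frobInner B A = (B * A).trace := by
  have hB' : B.transpose = B := hB
  rw [frobInner_eq_trace, hB']


/-- A finite set `S` that is covariance stable with respect to `Sig`, and a corruption `T` of it.
Of the covariance `Sig` only its distortion of the Frobenius norm matters. -/
structure CorruptedPair [DecidableEq α] (ε γ : ℝ) (S T : Finset α) (y : α → ι → ℝ) (Sig : Matrix ι ι ℝ) : Prop where
  eps_pos : 0 < ε
  eps_le : ε ≤ γ
  eps_small : ε ≤ 1 / 1000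
  nonempty : S.Nonempty
  card_eq : T.card = S.card
  card_inter : (1 - ε) * (S.card : ℝ) ≤ ((S ∩ T).card : ℝ)
  stable : IsCovStable ε γ S y Sig
  symm : Sig.IsSymm
  le_trace : ∀ B : Matrix ι ι ℝ, B.IsSymm → ‖B‖ ^ 2 ≤ (B * Sig * B * Sig).trace
  trace_le : ∀ B : Matrix ι ι ℝ, B.IsSymm → (B * Sig * B * Sig).trace ≤ 4 * ‖B‖ ^ 2
  trace_sub_le : ∀ B : Matrix ι ι ℝ, B.IsSymm → ∀ A : Matrix ι ι ℝ,
    |(B * (Sig + A) * B * (Sig + A)).trace - (B * Sig * B * Sig).trace| ≤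
      (4 * ‖A‖ + ‖A‖ ^ 2) * ‖B‖ ^ 2

/-- The error of the empirical second moments of `T`. -/
noncomputable def momentError (T : Finset α) (y : α → ι → ℝ) (Sig : Matrix ι ι ℝ) :
    Matrix ι ι ℝ :=
  familyMoment (fun x : T => y x) - Sig

namespace CorruptedPair

variable {ε γ : ℝ} {S T : Finset α} {y : α → ι → ℝ} {Sig : Matrix ι ι ℝ}

theorem frobInner_deviation {B : Matrix ι ι ℝ} (hB : B.IsSymm) (x : T) :
    frobInner B (deviation (fun x : T => y x) x) =
      centredForm y Sig B x - frobInner B (momentError T y Sig) := by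
  simp only [deviation, momentError, map_sub, frobInner_vecMulVec hB, centredForm,
    frobInner_eq_trace_mul hB Sig]
  ring

omit [Fintype ι] in
theorem sum_deviation (h : T.Nonempty) : ∑ x : T, deviation (fun x : T => y x) x = 0 := by
  have : (T.card : ℝ) ≠ 0 := by exact_mod_cast h.card_pos.ne'
  ext p q
  simp only [deviation, Matrix.sum_apply, Matrix.sub_apply, Matrix.vecMulVec_apply,
    Finset.sum_sub_distrib, familyMoment, Matrix.of_apply]
  simp
  field_simp
  simp

/-- The error of the second moments is what the forms average to over `T`. -/
theorem sum_centredForm (h : T.Nonempty) {B : Matrix ι ι ℝ} (hB : B.IsSymm) :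
    ∑ x ∈ T, centredForm y Sig B x = T.card * frobInner B (momentError T y Sig) := by
  have h1 : frobInner B (∑ x : T, deviation (fun x : T => y x) x) = 0 := by
    rw [sum_deviation h, map_zero]
  rw [map_sum] at h1
  simp only [frobInner_deviation (Sig := Sig) hB, Finset.sum_sub_distrib] at h1
  rw [Finset.sum_coe_sort T (fun x => centredForm y Sig B x)] at h1
  simp at h1
  linarith

variable [DecidableEq α]

theorem card_outliers_le (h : CorruptedPair ε γ S T y Sig) :
    ((T \ S).card : ℝ) ≤ ε * S.card := by
  have h1 : (T \ S).card + (S ∩ T).card = T.card := by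
    rw [Finset.inter_comm]; exact Finset.card_sdiff_add_card_inter T S
  have h2 : ((T \ S).card : ℝ) + (S ∩ T).card = S.card := by
    rw [← h.card_eq]; exact_mod_cast h1
  linarith [h.card_inter]

theorem sum_eq (f : α → ℝ) : ∑ x ∈ T, f x = ∑ x ∈ S ∩ T, f x + ∑ x ∈ T \ S, f x := by
  rw [Finset.inter_comm, add_comm]
  rw [← Finset.sum_inter_add_sum_sdiff T S f, add_comm]

/-- The standard deviation of a quadratic form under the Gaussian with covariance `Sig`. -/
theorem exists_scale (h : CorruptedPair ε γ S T y Sig) {B : Matrix ι ι ℝ} (hB : B.IsSymm)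
    (hB0 : B ≠ 0) : ∃ b : ℝ, 0 < b ∧ 2 * (B * Sig * B * Sig).trace = b ^ 2 ∧
      b ^ 2 ≤ 8 * ‖B‖ ^ 2 := by
  have h1 : 0 < ‖B‖ := norm_pos_iff.2 hB0
  have h2 := h.le_trace B hB
  have h3 := h.trace_le B hB
  have h4 : 0 < 2 * (B * Sig * B * Sig).trace := by nlinarith
  refine ⟨√(2 * (B * Sig * B * Sig).trace), Real.sqrt_pos.2 h4, ?_, ?_⟩
  · rw [Real.sq_sqrt h4.le]
  · rw [Real.sq_sqrt h4.le]; linarith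

/-- The empirical second moments give nearly the same Gaussian variance as `Sig`. -/
theorem abs_frobInner_conj_sub_le (h : CorruptedPair ε γ S T y Sig) {B : Matrix ι ι ℝ} (hB : B.IsSymm) :
    |2 * frobInner B (familyMoment (fun x : T => y x) * B * familyMoment fun x : T => y x) -
      2 * (B * Sig * B * Sig).trace| ≤
      (8 * ‖momentError T y Sig‖ + 2 * ‖momentError T y Sig‖ ^ 2) * ‖B‖ ^ 2 := by
  have h1 := h.trace_sub_le B hB (momentError T y Sig)
  have h2 : Sig + momentError T y Sig = familyMoment fun x : T => y x := by
    simp [momentError]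
  rw [h2] at h1
  rw [frobInner_eq_trace_mul hB, ← mul_sub, abs_mul, abs_two]
  simp only [← Matrix.mul_assoc] at h1 ⊢
  linarith

omit [DecidableEq α] in
theorem sum_sq_deviation (B : Matrix ι ι ℝ) (hB : B.IsSymm) :
    ∑ x : T, frobInner B (deviation (fun x : T => y x) x) ^ 2 =
      ∑ x ∈ T, (centredForm y Sig B x - frobInner B (momentError T y Sig)) ^ 2 := by
  simp only [frobInner_deviation (Sig := Sig) hB]
  exact Finset.sum_coe_sort T
    (fun x => (centredForm y Sig B x - frobInner B (momentError T y Sig)) ^ 2)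

theorem momentError_isSymm (h : CorruptedPair ε γ S T y Sig) : (momentError T y Sig).IsSymm := by
  have h1 : (familyMoment fun x : T => y x).transpose = _ := familyMoment_isSymm _
  have h2 : Sig.transpose = Sig := h.symm
  simp [momentError, Matrix.IsSymm, h1, h2]

theorem card_inter_le : ((S ∩ T).card : ℝ) ≤ S.card := by
  exact_mod_cast Finset.card_le_card Finset.inter_subset_left

theorem sq_error_pos (h : CorruptedPair ε γ S T y Sig)
    (ha : 800 * γ ≤ ‖momentError T y Sig‖) : 0 < ‖momentError T y Sig‖ := by
  linarith [h.eps_pos, h.eps_le]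

/-- In the direction of the error of the second moments, the outliers alone have a large mean. -/
theorem le_sum_outliers (h : CorruptedPair ε γ S T y Sig)
    (ha : 800 * γ ≤ ‖momentError T y Sig‖) :
    S.card * (0.99 * ‖momentError T y Sig‖ ^ 2) ≤
      ∑ x ∈ T \ S, centredForm y Sig (momentError T y Sig) x := by
  have hn : (0 : ℝ) < S.card := by exact_mod_cast h.nonempty.card_pos
  have hT : T.Nonempty := by rw [← Finset.card_pos, h.card_eq]; exact h.nonempty.card_pos
  have hA := h.momentError_isSymm
  have ha0 := h.sq_error_pos ha
  have hA0 : momentError T y Sig ≠ 0 := norm_pos_iff.1 ha0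
  obtain ⟨b, hb, hbB, hb8⟩ := h.exists_scale hA hA0
  have hsum := sum_centredForm (Sig := Sig) (y := y) hT hA
  rw [frobInner_self, h.card_eq, sum_eq (S := S)] at hsum
  have hin := (abs_le.1 (h.stable.sum_bounds hA hb hbB Finset.inter_subset_left h.card_inter).1).2
  set a := ‖momentError T y Sig‖
  have hγ : 0 < γ := h.eps_pos.trans_le h.eps_le
  have hb3 : b ≤ 3 * a := by nlinarith
  have h1 : γ * b * (S ∩ T).card ≤ γ * b * S.card :=
    mul_le_mul_of_nonneg_left card_inter_le (by positivity)
  have h2 : γ * b ≤ 0.01 * a ^ 2 := by nlinarith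
  have h3 := mul_le_mul_of_nonneg_right h2 hn.le
  nlinarith

/-- There is an outlier, so that the corruption rate is at least `1 / |S|`. -/
theorem one_le_eps_mul_card (h : CorruptedPair ε γ S T y Sig)
    (ha : 800 * γ ≤ ‖momentError T y Sig‖) : 1 ≤ ε * S.card := by
  have hn : (0 : ℝ) < S.card := by exact_mod_cast h.nonempty.card_pos
  have h1 := h.le_sum_outliers ha
  have h2 : 0 < ∑ x ∈ T \ S, centredForm y Sig (momentError T y Sig) x := by
    have := h.sq_error_pos ha
    exact lt_of_lt_of_le (by positivity) h1
  have h3 : (T \ S).Nonempty := by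
    by_contra h0
    simp [Finset.not_nonempty_iff_eq_empty.1 h0] at h2
  refine le_trans ?_ h.card_outliers_le
  exact_mod_cast h3.card_pos

/-- The arithmetic of the excess of the error: `b` is its Gaussian standard deviation, and `Q` and `Qo`
are the sums of its squared values over all points and over the outliers. -/
theorem excess_numeric {ε γ a b n Q Qo : ℝ} (hε : 0 < ε) (hεγ : ε ≤ γ) (hε1 : ε ≤ 1 / 1000)
    (ha : 800 * γ ≤ a) (hn : 0 < n) (hb8 : b ^ 2 ≤ 8 * a ^ 2) (h1 : 0.9 * a ^ 4 * n ≤ ε * Qo)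
    (h2 : n * (b ^ 2 * (1 - ε - γ ^ 2 / ε)) + Qo ≤ Q) :
    a ^ 2 / (5 * ε) * a ^ 2 ≤ (Q - 2 * (n * a ^ 2) * a ^ 2 + n * (a ^ 2) ^ 2) / n - b ^ 2 -
      (8 * a + 2 * a ^ 2) * a ^ 2 := by
  have hγ : 0 < γ := hε.trans_le hεγ
  have ha0 : 0 < a := by linarith
  have h3 : (n * (b ^ 2 * (1 - ε - γ ^ 2 / ε)) + Qo - n * a ^ 4) / n ≤
      (Q - 2 * (n * a ^ 2) * a ^ 2 + n * (a ^ 2) ^ 2) / n := by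
    refine div_le_div_of_nonneg_right ?_ hn.le
    have : 2 * (n * a ^ 2) * a ^ 2 - n * (a ^ 2) ^ 2 = n * a ^ 4 := by ring
    linarith
  have e1 : 0.9 * a ^ 4 / ε ≤ Qo / n := by
    rw [div_le_div_iff₀ hε hn]; linarith
  have e2 : (n * (b ^ 2 * (1 - ε - γ ^ 2 / ε)) + Qo - n * a ^ 4) / n =
      b ^ 2 - b ^ 2 * (ε + γ ^ 2 / ε) + Qo / n - a ^ 4 := by
    rw [sub_div, add_div, mul_div_cancel_left₀ _ hn.ne', mul_div_cancel_left₀ _ hn.ne']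
    ring
  rw [e2] at h3
  have e3 : a ^ 2 / (5 * ε) * a ^ 2 = 0.2 * a ^ 4 / ε := by
    rw [div_mul_eq_mul_div, div_eq_div_iff (by positivity) hε.ne']
    ring
  rw [e3]
  have e4 : b ^ 2 * (ε + γ ^ 2 / ε) ≤ 8 * a ^ 2 * (ε + γ ^ 2 / ε) :=
    mul_le_mul_of_nonneg_right hb8 (by positivity)
  have e5 : 8 * a ^ 2 * (ε + γ ^ 2 / ε) + 3 * a ^ 4 + 8 * a ^ 3 ≤ 0.7 * a ^ 4 / ε := by
    rw [le_div_iff₀ hε]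
    have : (8 * a ^ 2 * (ε + γ ^ 2 / ε) + 3 * a ^ 4 + 8 * a ^ 3) * ε =
        a ^ 2 * (8 * ε ^ 2 + 8 * γ ^ 2 + 3 * (a ^ 2 * ε) + 8 * (a * ε)) := by
      have : γ ^ 2 / ε * ε = γ ^ 2 := div_mul_cancel₀ _ hε.ne'
      linear_combination 8 * a ^ 2 * this
    rw [this, show 0.7 * a ^ 4 = a ^ 2 * (0.7 * a ^ 2) by ring]
    refine mul_le_mul_of_nonneg_left ?_ (sq_nonneg a)
    have f1 : γ ^ 2 ≤ (a / 800) ^ 2 := pow_le_pow_left₀ hγ.le (by linarith) 2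
    have f2 : ε ^ 2 ≤ γ ^ 2 := pow_le_pow_left₀ hε.le hεγ 2
    have f3 : a * ε ≤ a * (a / 800) := mul_le_mul_of_nonneg_left (by linarith) ha0.le
    have f4 : a ^ 2 * ε ≤ a ^ 2 * (1 / 1000) := mul_le_mul_of_nonneg_left hε1 (sq_nonneg a)
    have f5 : 0 ≤ a ^ 2 := sq_nonneg a
    linarith
  have e6 : 0.9 * a ^ 4 / ε = 0.2 * a ^ 4 / ε + 0.7 * a ^ 4 / ε := by ring
  have e7 : (8 * a + 2 * a ^ 2) * a ^ 2 = 8 * a ^ 3 + 2 * a ^ 4 := by ring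
  linarith

/-- The second moment of the inliers after the centre of the form has been moved by `t`; here `c` is
the number of inliers, and `q₁` and `q₂` are the sums of the values and of their squares. -/
theorem inlier_numeric {ε γ a b t n c N q₁ q₂ : ℝ} (hε : 0 < ε) (hγ : 0 < γ) (hb : 0 < b)
    (hc : 0 ≤ c) (hcn : c ≤ n) (hb8 : b ^ 2 ≤ 8 * N) (ht2 : t ^ 2 ≤ N * a ^ 2)
    (h1 : |q₁| ≤ γ * b * c) (h2 : q₂ - b ^ 2 * c ≤ b ^ 2 * (γ ^ 2 / ε) * c) :
    q₂ - 2 * q₁ * t + c * t ^ 2 ≤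
      n * (b ^ 2 + 8 * N * (γ ^ 2 / ε) + 2 * (N * a ^ 2) + 8 * N * γ ^ 2) := by
  have hg : 0 ≤ γ ^ 2 / ε := by positivity
  have f1 : -(q₁ * t) ≤ γ * b * c * |t| := by
    refine (neg_le_abs _).trans ?_
    rw [abs_mul]
    exact mul_le_mul_of_nonneg_right h1 (abs_nonneg t)
  have f2 : 2 * (γ * b * |t|) ≤ t ^ 2 + γ ^ 2 * b ^ 2 := by
    nlinarith [sq_nonneg (γ * b - |t|), sq_abs t]
  have f3 := mul_le_mul_of_nonneg_left f2 hc
  have f4 := mul_le_mul_of_nonneg_right hb8 hg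
  have f5 := mul_le_mul_of_nonneg_left hb8 (sq_nonneg γ)
  have f6 : q₂ - 2 * q₁ * t + c * t ^ 2 ≤
      c * (b ^ 2 + b ^ 2 * (γ ^ 2 / ε) + 2 * t ^ 2 + γ ^ 2 * b ^ 2) := by linarith
  have f7 : 0 ≤ b ^ 2 + b ^ 2 * (γ ^ 2 / ε) + 2 * t ^ 2 + γ ^ 2 * b ^ 2 := by positivity
  refine f6.trans ((mul_le_mul_of_nonneg_right hcn f7).trans ?_)
  exact mul_le_mul_of_nonneg_left (by linarith) (hc.trans hcn)

/-- The inlier terms, on the left and in the subtracted terms on the right, are small compared to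
`a ^ 2 / (10 * ε)`, as `ε` and `γ` are at most `a / 800`. -/
theorem outlier_numeric {ε γ a : ℝ} (hε : 0 < ε) (hεγ : ε ≤ γ) (hε1 : ε ≤ 1 / 1000)
    (ha : 800 * γ ≤ a) :
    2 * (48 * (γ ^ 2 / ε) + 2 * ε * a ^ 2) <
      a ^ 2 / (10 * ε) - (8 * a + 4 * a ^ 2) - 8 * (γ ^ 2 / ε) - 8 * γ ^ 2 := by
  have hγ : 0 < γ := hε.trans_le hεγ
  have ha0 : 0 < a := by linarith
  have e1 : 104 * γ ^ 2 + 4 * (ε ^ 2 * a ^ 2) + 8 * (a * ε) + 4 * (a ^ 2 * ε) + 8 * (ε * γ ^ 2) <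
      a ^ 2 / 10 := by
    have f1 : γ ^ 2 ≤ (a / 800) ^ 2 := pow_le_pow_left₀ hγ.le (by linarith) 2
    have f3 : a * ε ≤ a * (a / 800) := mul_le_mul_of_nonneg_left (by linarith) ha0.le
    have f4 : a ^ 2 * ε ≤ a ^ 2 * (1 / 1000) := mul_le_mul_of_nonneg_left hε1 (sq_nonneg a)
    have f5 : ε * γ ^ 2 ≤ 1 / 1000 * γ ^ 2 := mul_le_mul_of_nonneg_right hε1 (sq_nonneg γ)
    have f6 : ε ^ 2 * a ^ 2 ≤ (1 / 1000) ^ 2 * a ^ 2 :=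
      mul_le_mul_of_nonneg_right (pow_le_pow_left₀ hε.le hε1 2) (sq_nonneg a)
    have f7 : 0 < a ^ 2 := by positivity
    linarith
  have e2 := div_lt_div_of_pos_right e1 hε
  have e3 : (104 * γ ^ 2 + 4 * (ε ^ 2 * a ^ 2) + 8 * (a * ε) + 4 * (a ^ 2 * ε) +
      8 * (ε * γ ^ 2)) / ε =
      104 * (γ ^ 2 / ε) + 4 * ε * a ^ 2 + 8 * a + 4 * a ^ 2 + 8 * γ ^ 2 := by
    field_simp
  have e4 : a ^ 2 / 10 / ε = a ^ 2 / (10 * ε) := by rw [div_div]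
  rw [e3, e4] at e2
  linarith

/-- The error of the second moments is a quadratic form of large excess: a large mean on few outliers
makes for a large second moment. -/
theorem le_excess_momentError (h : CorruptedPair ε γ S T y Sig)
    (ha : 800 * γ ≤ ‖momentError T y Sig‖) :
    ‖momentError T y Sig‖ ^ 2 / (5 * ε) * ‖momentError T y Sig‖ ^ 2 ≤
      excess (fun x : T => y x) (momentError T y Sig) := by
  have hn : (0 : ℝ) < S.card := by exact_mod_cast h.nonempty.card_pos
  have hT : T.Nonempty := by rw [← Finset.card_pos, h.card_eq]; exact h.nonempty.card_pos
  have hA := h.momentError_isSymm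
  have ha0 := h.sq_error_pos ha
  have hA0 : momentError T y Sig ≠ 0 := norm_pos_iff.1 ha0
  obtain ⟨b, hb, hbB, hb8⟩ := h.exists_scale hA hA0
  have hsum := sum_centredForm (Sig := Sig) (y := y) hT hA
  rw [frobInner_self, h.card_eq] at hsum
  have hin := (abs_le.1 (h.stable.sum_bounds hA hb hbB Finset.inter_subset_left h.card_inter).2).1
  have hconj := (abs_le.1 (h.abs_frobInner_conj_sub_le hA)).2
  have hout := h.le_sum_outliers ha
  have hcs := sq_sum_le_card_mul_sum_sq (s := T \ S)
    (f := centredForm y Sig (momentError T y Sig))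
  have hsq := sum_eq (S := S) (T := T) fun x => centredForm y Sig (momentError T y Sig) x ^ 2
  rw [excess, sum_sq_deviation _ hA (Sig := Sig), frobInner_self, Fintype.card_coe, h.card_eq]
  simp only [sub_sq, Finset.sum_add_distrib, Finset.sum_sub_distrib, ← Finset.sum_mul,
    ← Finset.mul_sum, hsum, Finset.sum_const, nsmul_eq_mul, h.card_eq]
  have hε := h.eps_pos
  have hεγ := h.eps_le
  have hε1 := h.eps_small
  have hI := h.card_inter
  have hI' := card_inter_le (S := S) (T := T)
  have hO := h.card_outliers_le
  set a := ‖momentError T y Sig‖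
  set n : ℝ := (S.card : ℝ)
  set Q := ∑ x ∈ T, centredForm y Sig (momentError T y Sig) x ^ 2
  set Qo := ∑ x ∈ T \ S, centredForm y Sig (momentError T y Sig) x ^ 2
  have hQo0 : 0 ≤ Qo := Finset.sum_nonneg fun _ _ => sq_nonneg _
  have h1 : 0.9 * a ^ 4 * n ≤ ε * Qo := by
    have e1 : (n * (0.99 * a ^ 2)) ^ 2 ≤ ε * n * Qo := by
      refine (pow_le_pow_left₀ (by positivity) hout 2).trans (hcs.trans ?_)
      gcongr
    have e2 : n * (0.9 * a ^ 4 * n) ≤ n * (ε * Qo) := by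
      have : 0 ≤ n ^ 2 * a ^ 4 := by positivity
      nlinarith
    exact le_of_mul_le_mul_left e2 hn
  have h2 : n * (b ^ 2 * (1 - ε - γ ^ 2 / ε)) + Qo ≤ Q := by
    have e1 : b ^ 2 * (γ ^ 2 / ε) * (S ∩ T).card ≤ b ^ 2 * (γ ^ 2 / ε) * n := by gcongr
    have e2 : b ^ 2 * ((1 - ε) * n) ≤ b ^ 2 * (S ∩ T).card := by gcongr
    linarith
  have h3 := excess_numeric hε hεγ hε1 ha hn hb8 h1 h2
  linarith

/-- For a form of large excess, the outliers outweigh every small set of inliers by a factor of two,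
although the form is centred by the corrupted second moments. -/
theorem two_mul_sum_lt_sum_outliers (h : CorruptedPair ε γ S T y Sig)
    (ha : 800 * γ ≤ ‖momentError T y Sig‖) {B : Matrix ι ι ℝ} (hB : B.IsSymm) (hB0 : B ≠ 0)
    (hex : ‖momentError T y Sig‖ ^ 2 / (10 * ε) * ‖B‖ ^ 2 ≤ excess (fun x : T => y x) B)
    {L : Finset α} (hL : L ⊆ S) (hLc : (L.card : ℝ) ≤ ε * S.card) :
    2 * ∑ x ∈ L, (centredForm y Sig B x - frobInner B (momentError T y Sig)) ^ 2 <
      ∑ x ∈ T \ S, (centredForm y Sig B x - frobInner B (momentError T y Sig)) ^ 2 := by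
  have hn : (0 : ℝ) < S.card := by exact_mod_cast h.nonempty.card_pos
  have ha0 := h.sq_error_pos ha
  obtain ⟨b, hb, hbB, hb8⟩ := h.exists_scale hB hB0
  have hBpos : 0 < ‖B‖ := norm_pos_iff.2 hB0
  have hin := h.stable.sum_bounds hB hb hbB Finset.inter_subset_left h.card_inter
  have hin1 := hin.1
  have hin2 := (abs_le.1 hin.2).2
  have hconj := (abs_le.1 (h.abs_frobInner_conj_sub_le hB)).1
  have hLq := h.stable.sum_sq_le_of_card_le h.eps_pos h.eps_le hB hb hbB hL hLc
  have hsq := sum_eq (S := S) (T := T)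
    fun x => (centredForm y Sig B x - frobInner B (momentError T y Sig)) ^ 2
  rw [excess, sum_sq_deviation _ hB (Sig := Sig), Fintype.card_coe, h.card_eq, hsq] at hex
  have ht := abs_frobInner_le B (momentError T y Sig)
  have hε := h.eps_pos
  have hεγ := h.eps_le
  have hε1 := h.eps_small
  have hI' := card_inter_le (S := S) (T := T)
  set a := ‖momentError T y Sig‖
  set n : ℝ := (S.card : ℝ)
  set t := frobInner B (momentError T y Sig)
  set N := ‖B‖ ^ 2 with hN
  have hN0 : 0 < N := by positivity
  have ht2 : t ^ 2 ≤ N * a ^ 2 := by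
    rw [← sq_abs, hN, ← mul_pow]
    exact pow_le_pow_left₀ (abs_nonneg _) ht 2
  set Po := ∑ x ∈ T \ S, (centredForm y Sig B x - t) ^ 2
  have hγ : 0 < γ := hε.trans_le hεγ
  have hPL : ∑ x ∈ L, (centredForm y Sig B x - t) ^ 2 ≤
      n * (N * (48 * (γ ^ 2 / ε) + 2 * ε * a ^ 2)) := by
    have e1 : ∑ x ∈ L, (centredForm y Sig B x - t) ^ 2 ≤
        ∑ x ∈ L, (2 * centredForm y Sig B x ^ 2 + 2 * t ^ 2) :=
      Finset.sum_le_sum fun x _ => by nlinarith [sq_nonneg (centredForm y Sig B x + t)]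
    rw [Finset.sum_add_distrib, ← Finset.mul_sum, Finset.sum_const, nsmul_eq_mul] at e1
    have e2 : (L.card : ℝ) * (2 * t ^ 2) ≤ ε * n * (2 * (N * a ^ 2)) :=
      mul_le_mul hLc (by linarith) (by positivity) (by positivity)
    have e3 : n * (3 * b ^ 2 * (γ ^ 2 / ε)) ≤ n * (3 * (8 * N) * (γ ^ 2 / ε)) :=
      mul_le_mul_of_nonneg_left
        (mul_le_mul_of_nonneg_right (by linarith) (by positivity)) hn.le
    linarith
  have hPin : ∑ x ∈ S ∩ T, (centredForm y Sig B x - t) ^ 2 ≤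
      n * (b ^ 2 + 8 * N * (γ ^ 2 / ε) + 2 * (N * a ^ 2) + 8 * N * γ ^ 2) := by
    have e1 : ∑ x ∈ S ∩ T, (centredForm y Sig B x - t) ^ 2 =
        ∑ x ∈ S ∩ T, centredForm y Sig B x ^ 2 - 2 * (∑ x ∈ S ∩ T, centredForm y Sig B x) * t +
          (S ∩ T).card * t ^ 2 := by
      simp only [sub_sq, Finset.sum_add_distrib, Finset.sum_sub_distrib, ← Finset.sum_mul,
        ← Finset.mul_sum, Finset.sum_const, nsmul_eq_mul]
    rw [e1]
    exact inlier_numeric hε hγ hb (Nat.cast_nonneg _) hI' hb8 ht2 hin1 hin2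
  have hPo : n * (N * (a ^ 2 / (10 * ε) - (8 * a + 4 * a ^ 2) - 8 * (γ ^ 2 / ε) - 8 * γ ^ 2)) ≤
      Po := by
    have e1 : a ^ 2 / (10 * ε) * N + b ^ 2 - (8 * a + 2 * a ^ 2) * N ≤
        (∑ x ∈ S ∩ T, (centredForm y Sig B x - t) ^ 2 + Po) / n := by linarith
    rw [le_div_iff₀ hn] at e1
    linarith
  refine lt_of_lt_of_le ?_ hPo
  have hnN : 0 < n * N := by positivity
  have key := mul_lt_mul_of_pos_left (outlier_numeric hε hεγ hε1 ha) hnN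
  linarith

end CorruptedPair
end Corruption
end SparsePCA

/-! ### Ranking and scores -/

namespace SparsePCA

section Ranking

variable {κ Λ : Type*} [Fintype κ] [LinearOrder Λ]

/-- The number of elements in front of `x` in the order given by `key`. -/
def rank (key : κ → Λ) (x : κ) : ℕ := (Finset.univ.filter fun z => key z < key x).card

/-- The elements that are among the first `m` in the order given by `key`. -/
noncomputable def firstElements (key : κ → Λ) (m : ℝ) : Finset κ :=
  Finset.univ.filter fun x => ¬ m < rank key x + 1

theorem rank_mono {key : κ → Λ} {x z : κ} (h : key x ≤ key z) : rank key x ≤ rank key z :=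
  Finset.card_le_card fun w hw => by
    simp only [Finset.mem_filter, Finset.mem_univ, true_and] at hw ⊢
    exact hw.trans_le h

theorem card_firstElements_le {key : κ → Λ} (hkey : Function.Injective key) {m : ℝ} (hm : 0 ≤ m) :
    ((firstElements key m).card : ℝ) ≤ m := by
  classical
  rcases (firstElements key m).eq_empty_or_nonempty with h | h
  · simpa [h] using hm
  · obtain ⟨x, hx, hmax⟩ := Finset.exists_max_image _ key h
    have h1 : (firstElements key m).erase x ⊆ Finset.univ.filter fun z => key z < key x := by
      intro z hz
      rw [Finset.mem_erase] at hz
      simp only [Finset.mem_filter, Finset.mem_univ, true_and]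
      exact lt_of_le_of_ne (hmax z hz.2) fun he => hz.1 (hkey he)
    have h2 := Finset.card_le_card h1
    rw [Finset.card_erase_of_mem hx] at h2
    have h3 : (firstElements key m).card ≤ rank key x + 1 := by
      unfold rank; omega
    have h4 : ¬ m < rank key x + 1 := by simpa [firstElements] using hx
    have h5 : ((firstElements key m).card : ℝ) ≤ (rank key x : ℝ) + 1 := by exact_mod_cast h3
    linarith

/-- The first elements have the largest sum among all sets of their size. -/
theorem sum_le_sum_firstElements {key : κ → Λ} {g : κ → ℝ} (hg : ∀ x, 0 ≤ g x)
    (hkey : ∀ x z, key x ≤ key z → g z ≤ g x) {m : ℝ} {U : Finset κ} (hU : (U.card : ℝ) ≤ m) :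
    ∑ x ∈ U, g x ≤ ∑ x ∈ firstElements key m, g x := by
  classical
  set F := firstElements key m with hF
  have hmem : ∀ x, x ∈ F ↔ ¬ m < rank key x + 1 := fun x => by simp [hF, firstElements]
  rcases Fᶜ.eq_empty_or_nonempty with h | h
  · rw [Finset.compl_eq_empty_iff] at h
    rw [h]
    exact Finset.sum_le_sum_of_subset_of_nonneg (Finset.subset_univ U) fun x _ _ => hg x
  · obtain ⟨z, hz, hmin⟩ := Finset.exists_min_image _ key h
    rw [Finset.mem_compl] at hz
    have hFz : ∀ x ∈ F, g z ≤ g x := by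
      intro x hx
      refine hkey x z (le_of_lt (lt_of_not_ge fun hzx => hz ?_))
      rw [hmem] at hx ⊢
      have : (rank key z : ℝ) ≤ rank key x := by exact_mod_cast rank_mono hzx
      linarith
    have hFcz : ∀ x ∉ F, g x ≤ g z := fun x hx => hkey z x (hmin x (Finset.mem_compl.2 hx))
    have hrank : rank key z ≤ F.card := by
      refine Finset.card_le_card fun x hx => ?_
      simp only [Finset.mem_filter, Finset.mem_univ, true_and] at hx
      by_contra hxF
      exact absurd (hmin x (Finset.mem_compl.2 hxF)) (not_le.2 hx)
    have hcard : U.card ≤ F.card := by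
      rw [hmem, not_not] at hz
      have h1 : (rank key z : ℝ) ≤ F.card := by exact_mod_cast hrank
      have h2 : (U.card : ℝ) < F.card + 1 := by linarith
      have h3 : U.card < F.card + 1 := by exact_mod_cast h2
      omega
    have hcard' : (U \ F).card ≤ (F \ U).card := by
      have h1 := Finset.card_sdiff_add_card_inter U F
      have h2 := Finset.card_sdiff_add_card_inter F U
      rw [Finset.inter_comm] at h2
      omega
    have h1 : ∑ x ∈ U \ F, g x ≤ (U \ F).card * g z := by
      rw [← nsmul_eq_mul]
      exact Finset.sum_le_card_nsmul _ _ _ fun x hx => hFcz x (Finset.mem_sdiff.1 hx).2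
    have h2 : (F \ U).card * g z ≤ ∑ x ∈ F \ U, g x := by
      rw [← nsmul_eq_mul]
      exact Finset.card_nsmul_le_sum _ _ _ fun x hx => hFz x (Finset.mem_sdiff.1 hx).1
    have h3 : ((U \ F).card : ℝ) * g z ≤ (F \ U).card * g z :=
      mul_le_mul_of_nonneg_right (by exact_mod_cast hcard') (hg z)
    have h4 := Finset.sum_inter_add_sum_sdiff U F g
    have h5 := Finset.sum_inter_add_sum_sdiff F U g
    rw [Finset.inter_comm] at h5
    linarith

end Ranking

section Score

variable {α ι Λ : Type*} [Fintype ι] [DecidableEq α] [LinearOrder Λ]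

/-- Squared values of a form of large excess, cut off below the `ε |S|` largest ones, are a filter
score. -/
theorem CorruptedPair.score {ε γ : ℝ} {S T : Finset α} {y : α → ι → ℝ} {Sig : Matrix ι ι ℝ}
    (h : CorruptedPair ε γ S T y Sig)
    (ha : 800 * γ ≤ ‖momentError T y Sig‖) {B : Matrix ι ι ℝ} (hB : B.IsSymm) (hB0 : B ≠ 0)
    (hex : ‖momentError T y Sig‖ ^ 2 / (10 * ε) * ‖B‖ ^ 2 ≤ excess (fun x : T => y x) B)
    {key : T → Λ} (hinj : Function.Injective key)
    (hkey : ∀ x z, key x ≤ key z → frobInner B (deviation (fun x : T => y x) z) ^ 2 ≤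
      frobInner B (deviation (fun x : T => y x) x) ^ 2) {f : T → ℝ}
    (hf : ∀ x, f x = if ε * S.card < rank key x + 1 then 0
      else frobInner B (deviation (fun x : T => y x) x) ^ 2) :
    (∀ x, 0 ≤ f x) ∧ (∑ x ∈ T.attach with x.val ∈ S, f x ≤ ∑ x ∈ T.attach with x.val ∉ S, f x) ∧
      ∃ x, 0 < f x := by
  have hf0 : ∀ x, 0 ≤ f x := by
    intro x
    rw [hf]
    split_ifs
    exacts [le_rfl, sq_nonneg _]
  set g : T → ℝ := fun x => frobInner B (deviation (fun x : T => y x) x) ^ 2 with hg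
  set p : α → ℝ := fun x => (centredForm y Sig B x - frobInner B (momentError T y Sig)) ^ 2
  have hgp : ∀ x : T, g x = p x := fun x => by
    simp only [hg, p, frobInner_deviation (Sig := Sig) hB]
  set F := firstElements key (ε * S.card) with hF
  have hfF : ∀ x, f x = if x ∈ F then g x else 0 := by
    intro x
    rw [hf x]
    simp only [hF, firstElements, Finset.mem_filter, Finset.mem_univ, true_and, ite_not, hg]
  have hFc : (F.card : ℝ) ≤ ε * S.card :=
    card_firstElements_le hinj (mul_nonneg h.eps_pos.le (Nat.cast_nonneg _))
  have hUsum : ∑ x ∈ T.attach with x.val ∉ S, g x = ∑ x ∈ T \ S, p x := by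
    rw [Finset.sdiff_eq_filter, Finset.sum_filter, Finset.sum_filter]
    simp only [hgp]
    exact Finset.sum_attach T fun x => if x ∉ S then p x else 0
  have hUc : ((T.attach.filter fun x => x.val ∉ S).card : ℝ) ≤ ε * S.card := by
    refine le_trans (le_of_eq ?_) h.card_outliers_le
    rw [Finset.sdiff_eq_filter, ← Finset.card_map (Function.Embedding.subtype _)]
    congr 2
    ext x
    simp [and_comm]
  have h1 := sum_le_sum_firstElements (key := key) (g := g) (fun x => sq_nonneg _) hkey hUc
  have h2 := h.two_mul_sum_lt_sum_outliers ha hB hB0 hex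
    (L := (F.filter fun x => x.val ∈ S).map (Function.Embedding.subtype _))
    (by
      intro x hx
      simp only [Finset.mem_map, Finset.mem_filter] at hx
      obtain ⟨z, hz, rfl⟩ := hx
      exact hz.2)
    (by
      rw [Finset.card_map]
      exact le_trans (by exact_mod_cast Finset.card_filter_le _ _) hFc)
  rw [Finset.sum_map] at h2
  have e1 : ∑ x ∈ T.attach with x.val ∈ S, f x = ∑ x ∈ F with x.val ∈ S, g x := by
    rw [Finset.sum_congr rfl fun x _ => hfF x, ← Finset.sum_filter, Finset.filter_comm]
    congr 2
    ext x
    simp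
  have e2 : ∑ x ∈ T.attach with x.val ∉ S, f x = ∑ x ∈ F with x.val ∉ S, g x := by
    rw [Finset.sum_congr rfl fun x _ => hfF x, ← Finset.sum_filter, Finset.filter_comm]
    congr 2
    ext x
    simp
  have e3 : ∑ x ∈ F with x.val ∈ S, p x = ∑ x ∈ F with x.val ∈ S, g x :=
    Finset.sum_congr rfl fun x _ => (hgp x).symm
  have e4 := Finset.sum_filter_add_sum_filter_not F (fun x => x.val ∈ S) g
  rw [hUsum] at h1
  change 2 * ∑ x ∈ F with x.val ∈ S, p x < _ at h2
  rw [e3] at h2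
  have h3 : 0 ≤ ∑ x ∈ F with x.val ∈ S, g x := Finset.sum_nonneg fun _ _ => sq_nonneg _
  have h4 : ∑ x ∈ T \ S, p x =
      ∑ x ∈ T \ S, (centredForm y Sig B x - frobInner B (momentError T y Sig)) ^ 2 := rfl
  rw [e1, e2]
  refine ⟨hf0, by linarith, ?_⟩
  by_contra! hcon
  have h5 : ∑ x ∈ T.attach with x.val ∉ S, f x ≤ 0 := Finset.sum_nonpos fun x _ => hcon x
  rw [e2] at h5
  linarith

/-- The number `h³ n` of iterations suffices: the shift of the filter operator is at most of order
`h`, and the gain is at least of order `1 / n`, as the corruption rate is at least `1 / n`. -/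
theorem CorruptedPair.exists_powerIterate {ε γ : ℝ} {S T : Finset α} {y : α → ι → ℝ}
    {Sig : Matrix ι ι ℝ} [DecidableEq ι] [Nonempty ι] (h : CorruptedPair ε γ S T y Sig)
    (hSig : ‖Sig‖ ^ 2 ≤ 4 * Fintype.card ι) (ha : 800 * γ ≤ ‖momentError T y Sig‖) {L : ℕ}
    (hL : L = Fintype.card ι * Fintype.card ι * Fintype.card ι * S.card) :
    ∃ p q, (2 * ‖familyMoment fun x : T => y x‖ ^ 2 + ‖momentError T y Sig‖ ^ 2 / (10 * ε)) *
        ‖powerIterate (fun x : T => y x) L p q‖ ^ 2 <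
      frobInner (powerIterate (fun x : T => y x) L p q)
        (filterOp (fun x : T => y x) (powerIterate (fun x : T => y x) L p q)) := by
  have ha0 := h.sq_error_pos ha
  have hεn := h.one_le_eps_mul_card ha
  have hS : familyMoment (fun x : T => y x) = Sig + momentError T y Sig := by simp [momentError]
  have hε := h.eps_pos
  have hε1 := h.eps_small
  have hn1 : (1 : ℝ) ≤ S.card := by exact_mod_cast h.nonempty.card_pos
  have hh1 : (1 : ℝ) ≤ Fintype.card ι := by exact_mod_cast Fintype.card_pos
  have hex := h.le_excess_momentError ha
  have hA0 : momentError T y Sig ≠ 0 := norm_pos_iff.1 ha0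
  have hs : 2 * ‖familyMoment fun x : T => y x‖ ^ 2 ≤
      16 * Fintype.card ι + 4 * ‖momentError T y Sig‖ ^ 2 := by
    have h1 : ‖familyMoment fun x : T => y x‖ ≤ ‖Sig‖ + ‖momentError T y Sig‖ := by
      rw [hS]; exact norm_add_le _ _
    have h2 := pow_le_pow_left₀ (norm_nonneg _) h1 2
    nlinarith [sq_nonneg (‖Sig‖ - ‖momentError T y Sig‖)]
  have hγa : 800 * ε ≤ ‖momentError T y Sig‖ := by linarith [h.eps_le]
  have key : (Fintype.card ι : ℝ) ^ 2 * (2 * (2 * ‖familyMoment fun x : T => y x‖ ^ 2) +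
      ‖momentError T y Sig‖ ^ 2 / (5 * ε)) ≤ 2 * L * (‖momentError T y Sig‖ ^ 2 / (5 * ε)) := by
    set a := ‖momentError T y Sig‖
    set c : ℝ := (Fintype.card ι : ℝ)
    set n : ℝ := (S.card : ℝ)
    set lam := a ^ 2 / (5 * ε) with hlam
    have hlam0 : 0 < lam := by positivity
    have e1 : a ^ 2 = 5 * ε * lam := by rw [hlam]; field_simp
    have e2 : 128000 * ε ≤ lam := by
      rw [hlam, le_div_iff₀ (by positivity)]
      nlinarith
    have e3 : 128000 ≤ n * lam := by nlinarith
    have e4 : lam ≤ n * lam := by nlinarith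
    have e5 : n * lam ≤ c * (n * lam) := by nlinarith
    have e6 : 128000 * c ≤ c * (n * lam) := by nlinarith
    have e7 : a ^ 2 ≤ 0.005 * lam := by nlinarith
    have e8 : 2 * (2 * ‖familyMoment fun x : T => y x‖ ^ 2) + lam ≤ 2 * (c * (n * lam)) := by
      nlinarith
    have e9 := mul_le_mul_of_nonneg_left e8 (sq_nonneg c)
    rw [hL]
    push_cast
    refine e9.trans_eq ?_
    simp only [c, n]
    ring
  have := SparsePCA.exists_powerIterate (fun x : T => y x) h.momentError_isSymm hA0
    (by positivity) hex L key
  have e : ‖momentError T y Sig‖ ^ 2 / (5 * ε) / 2 = ‖momentError T y Sig‖ ^ 2 / (10 * ε) := by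
    rw [div_div]; ring_nf
  rwa [e] at this

end Score
end SparsePCA

/-! ### The program -/

namespace SparsePCA

section Program

open RealRAM LoopProg

/-- The counter in cell `0` of array `c`. -/
def ctr (c : ℕ) : NExp := .get c (.lit 0)

/-- The natural number `n` as a real. -/
def const (n : ℕ) : RExp := .ofNat (.lit n)

/-- The real in cell `(0, 0)` of array `a`. -/
def scalar (a : ℕ) : RExp := .get a (.lit 0) (.lit 0)

/-- Entry `(p, q)` of array `a`, for counters `p` and `q`. -/
def entry (a p q : ℕ) : RExp := .get a (ctr p) (ctr q)

/-- Entry `(i, 0)` of array `a`, for a counter `i`. -/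
def item (a i : ℕ) : RExp := .get a (ctr i) (.lit 0)

/-- Coordinate `p` in `H` of the point `i`, for counters `i` and `p`. -/
def coord (i p : ℕ) : RExp := .get 0 (ctr i) (.get 1 (ctr p))

/-- The number of points. -/
def size : RExp := .ofNat (.get 0 (.lit 1))

/-- Array `3` becomes the second moment matrix of the points. -/
def momentProg : LoopProg :=
  loop 2 2 (loop 3 2 (seq (setReal 3 (ctr 2) (ctr 3) (const 0))
    (loop 4 1 (addReal 3 (ctr 2) (ctr 3) (.div (.mul (coord 4 2) (coord 4 3)) size)))))

/-- Array `4` becomes the shift of the filter operator. -/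
def shiftProg : LoopProg :=
  seq (setReal 4 (.lit 0) (.lit 0) (const 0))
    (loop 2 2 (loop 3 2 (addReal 4 (.lit 0) (.lit 0)
      (.mul (const 2) (.mul (entry 3 2 3) (entry 3 2 3))))))

/-- Array `6` becomes the inner products of the matrix in array `b` with the deviations. -/
def formProg (b : ℕ) : LoopProg :=
  loop 4 1 (seq (setReal 6 (ctr 4) (.lit 0) (const 0))
    (loop 2 2 (loop 3 2 (addReal 6 (ctr 4) (.lit 0)
      (.mul (entry b 2 3) (.sub (.mul (coord 4 2) (coord 4 3)) (entry 3 2 3)))))))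

/-- Array `7` becomes the product of the matrices in arrays `3` and `5`. -/
def prodProg : LoopProg :=
  loop 2 2 (loop 3 2 (seq (setReal 7 (ctr 2) (ctr 3) (const 0))
    (loop 5 2 (addReal 7 (ctr 2) (ctr 3) (.mul (entry 3 2 5) (entry 5 5 3))))))

/-- Array `8` becomes the filter operator of the matrix in array `5`, from the contents of arrays
`3`, `4`, `6` and `7`. -/
def combineProg : LoopProg :=
  loop 2 2 (loop 3 2 (seq (setReal 8 (ctr 2) (ctr 3) (.mul (scalar 4) (entry 5 2 3)))
    (seq
      (loop 4 1 (addReal 8 (ctr 2) (ctr 3)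
        (.div (.mul (item 6 4) (.sub (.mul (coord 4 2) (coord 4 3)) (entry 3 2 3))) size)))
      (loop 5 2 (addReal 8 (ctr 2) (ctr 3)
        (.mul (.sub (const 0) (const 2)) (.mul (entry 7 2 5) (entry 3 5 3))))))))

/-- Array `8` becomes the filter operator of the matrix in array `5`. -/
def opProg : LoopProg := seq (formProg 5) (seq prodProg combineProg)

/-- Copy the matrix in array `a` to array `b`. -/
def copyProg (a b : ℕ) : LoopProg :=
  loop 2 2 (loop 3 2 (setReal b (ctr 2) (ctr 3) (entry a 2 3)))

/-- Iterate the filter operator on the matrix in array `5`. -/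
def iterateProg : LoopProg :=
  loop 6 2 (loop 7 2 (loop 8 2 (loop 9 1 (seq opProg (copyProg 8 5)))))

/-- Array `5` becomes the symmetric matrix unit of the counters `10` and `11`. -/
def unitProg : LoopProg :=
  seq (loop 2 2 (loop 3 2 (setReal 5 (ctr 2) (ctr 3) (const 0))))
    (seq (addReal 5 (ctr 10) (ctr 11) (const 1)) (addReal 5 (ctr 11) (ctr 10) (const 1)))

/-- The scalar in array `c` becomes the Frobenius inner product of arrays `a` and `b`. -/
def innerProg (a b c : ℕ) : LoopProg :=
  seq (setReal c (.lit 0) (.lit 0) (const 0))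
    (loop 2 2 (loop 3 2 (addReal c (.lit 0) (.lit 0) (.mul (entry a 2 3) (entry b 2 3)))))

/-- If the Rayleigh quotient of the matrix in array `5` exceeds the scalar in array `11`, record it
there, and the matrix in array `12`. -/
def recordProg : LoopProg :=
  guarded (.realLT (scalar 11) (.div (scalar 9) (scalar 10)))
    (seq (setReal 11 (.lit 0) (.lit 0) (.div (scalar 9) (scalar 10))) (copyProg 5 12))

/-- Run the power iteration from one symmetric matrix unit and record the outcome if it is the best
one so far. -/
def candidateProg : LoopProg :=
  seq unitProg (seq iterateProg (seq opProg (seq (innerProg 5 8 9) (seq (innerProg 5 5 10)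
    recordProg))))

/-- Array `12` becomes the best outcome of the power iteration. -/
def searchProg : LoopProg :=
  seq (setReal 11 (.lit 0) (.lit 0) (const 0)) (loop 10 2 (loop 11 2 candidateProg))

/-- The square of the entry of array `6` at the counter `i`. -/
def sqForm (i : ℕ) : RExp := .mul (item 6 i) (item 6 i)

/-- The point at counter `5` precedes the one at counter `4`: its squared form is larger, or it is
equal and the index is smaller. -/
def precedes : BExp :=
  .not (.and (.not (.realLT (sqForm 4) (sqForm 5)))
    (.not (.and (.not (.realLT (sqForm 5) (sqForm 4))) (.natLT (ctr 5) (ctr 4)))))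

/-- Array `13` becomes the ranks of the points: the numbers of points that precede them. -/
def rankProg : LoopProg :=
  loop 4 1 (seq (setReal 13 (ctr 4) (.lit 0) (const 0))
    (loop 5 1 (guarded precedes (addReal 13 (ctr 4) (.lit 0) (const 1)))))

/-- Array `2` becomes the scores: squared forms of the points whose rank is below `ε |T|`. -/
def cutProg : LoopProg :=
  loop 4 1 (seq (setReal 2 (ctr 4) (.lit 0) (const 0))
    (guarded (.not (.realLT (.mul (scalar 1) size) (.add (item 13 4) (const 1))))
      (addReal 2 (ctr 4) (.lit 0) (sqForm 4))))

/-- The scores for the quadratic form in array `12`. -/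
def scoreProg : LoopProg := seq (formProg 12) (seq rankProg cutProg)

/-- The filter. Arrays `0` and `1` hold the input and are never written to. The reals `3` and `4` hold
the second moments and the shift, `5` the current matrix, `6`, `7`, `8` the ingredients and the value
of the filter operator at it, `9` and `10` its Rayleigh quotient, `11` and `12` the best quotient and
matrix, `13` the ranks and `2` the scores. The naturals `2` to `11` are the loop counters. -/
def filterProg : LoopProg := seq momentProg (seq shiftProg (seq searchProg scoreProg))

theorem filterProg_wf : filterProg.wf = true := by decide

variable {n h : ℕ} {τ ι : Type*} (eT : Fin n ≃ τ) (eH : Fin h ≃ ι)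
  (Y : τ → ι → ℝ) (ε : ℝ)

/-- The input is in place. -/
structure HasInput (m : Mem) : Prop where
  n_eq : m.nat 0 1 = n
  h_eq : m.nat 0 2 = h
  points : ∀ x p, m.real 0 (eT.symm x) (m.nat 1 (eH.symm p)) = Y x p
  eps : m.real 1 0 0 = ε

/-- Array `a` of the reals `R` holds the matrix `B`. -/
def HoldsMatrix (R : ℕ → ℕ → ℕ → ℝ) (a : ℕ) (B : Matrix ι ι ℝ) : Prop :=
  ∀ p q, R a (eH.symm p) (eH.symm q) = B p q

/-- Column `0` of array `a` of the reals `R` holds the vector `v`. -/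
def HoldsVector (R : ℕ → ℕ → ℕ → ℝ) (a : ℕ) (v : τ → ℝ) : Prop :=
  ∀ x, R a (eT.symm x) 0 = v x

variable {eT eH Y ε}

theorem HasInput.frame {p : LoopProg} {m m' : Mem} (hm : HasInput eT eH Y ε m)
    (hF : Frame p m m') (h0 : p.writesNat 0 = false) (h1 : p.writesNat 1 = false)
    (h2 : p.writesReal 0 = false) (h3 : p.writesReal 1 = false) : HasInput eT eH Y ε m' := by
  refine ⟨?_, ?_, ?_, ?_⟩
  · rw [hF.nat 0 h0, hm.n_eq]
  · rw [hF.nat 0 h0, hm.h_eq]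
  · intro x p; rw [hF.nat 1 h1, hF.real 0 h2, hm.points]
  · rw [hF.real 1 h3, hm.eps]

theorem HoldsMatrix.frame {p : LoopProg} {m m' : Mem} {a : ℕ} {B : Matrix ι ι ℝ}
    (hB : HoldsMatrix eH m.real a B) (hF : Frame p m m') (h : p.writesReal a = false) :
    HoldsMatrix eH m'.real a B := by
  intro p q
  rw [hF.real a h, hB]

theorem HasInput.eval_coord {m : Mem} (hm : HasInput eT eH Y ε m) {i p : ℕ} {x : τ} {y : ι}
    (hi : m.nat i 0 = eT.symm x) (hp : m.nat p 0 = eH.symm y) : (coord i p).eval m = Y x y := by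
  simp [coord, ctr, RExp.eval, NExp.eval, hi, hp, hm.points]

theorem HoldsMatrix.eval_entry {m : Mem} {a p q : ℕ} {B : Matrix ι ι ℝ} {x y : ι}
    (hB : HoldsMatrix eH m.real a B)
    (hp : m.nat p 0 = eH.symm x) (hq : m.nat q 0 = eH.symm y) :
    (entry a p q).eval m = B x y := by
  simp [entry, ctr, RExp.eval, NExp.eval, hp, hq, hB x y]

theorem HoldsVector.eval_item {m : Mem} {a i : ℕ} {v : τ → ℝ} {x : τ}
    (hv : HoldsVector eT m.real a v) (hi : m.nat i 0 = eT.symm x) : (item a i).eval m = v x := by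
  simp [item, ctr, RExp.eval, NExp.eval, hi, hv x]

theorem eval_const (m : Mem) (k : ℕ) : (const k).eval m = k := by simp [const, RExp.eval, NExp.eval]

theorem eval_ctr (m : Mem) (c : ℕ) : (ctr c).eval m = m.nat c 0 := rfl

variable [Fintype τ]

theorem HasInput.eval_size {m : Mem} (hm : HasInput eT eH Y ε m) :
    size.eval m = Fintype.card τ := by
  simp [size, RExp.eval, NExp.eval, hm.n_eq, ← Fintype.card_congr eT]

theorem run_momentProg {m : Mem} (hm : HasInput eT eH Y ε m) :
    HoldsMatrix eH (momentProg.run m).real 3 (familyMoment Y) := by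
  refine matrix_loop rfl rfl rfl hm.h_eq eH _ fun p q m₁ F₁ hp hq => ?_
  rw [familyMoment, Matrix.of_apply, Finset.sum_div, ← zero_add (∑ _, _)]
  refine setsCell_seq_adds (setsCell_setReal hp hq (by simp [eval_const])) fun m₂ F₂ => ?_
  have hm₂ := (hm.frame F₁ rfl rfl rfl rfl).frame F₂ rfl rfl rfl rfl
  rw [← F₂.nat 2 rfl] at hp
  rw [← F₂.nat 3 rfl] at hq
  refine adds_loop rfl hm₂.n_eq eT _ fun x m₃ F₃ hx => ?_
  have hm₃ := hm₂.frame F₃ rfl rfl rfl rfl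
  rw [← F₃.nat 2 rfl] at hp
  rw [← F₃.nat 3 rfl] at hq
  refine adds_addReal hp hq ?_
  simp only [RExp.eval, hm₃.eval_coord hx hp, hm₃.eval_coord hx hq, hm₃.eval_size]

variable [Fintype ι]

theorem frobInner_deviation_eq_sum (Y : τ → ι → ℝ) (B : Matrix ι ι ℝ) (x : τ) :
    frobInner B (deviation Y x) = ∑ p, ∑ q, B p q * (Y x p * Y x q - familyMoment Y p q) := by
  simp [frobInner_eq_sum, deviation, Matrix.vecMulVec_apply]

theorem run_innerProg {m : Mem} {a b c : ℕ} {A B : Matrix ι ι ℝ} (hca : c ≠ a) (hcb : c ≠ b)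
    (hh : m.nat 0 2 = h) (hA : HoldsMatrix eH m.real a A) (hB : HoldsMatrix eH m.real b B) :
    ((innerProg a b c).run m).real c 0 0 = frobInner A B := by
  have hcell : SetsCell (innerProg a b c) m c 0 0 (0 + ∑ p, ∑ q, A p q * B p q) := by
    refine setsCell_seq_adds (setsCell_setReal rfl rfl (by simp [eval_const])) fun m₂ F₂ => ?_
    refine adds_loop_loop rfl rfl rfl ((congrFun (F₂.nat 0 rfl) 2).trans hh) eH _
      fun p q m₃ F₃ hp hq => ?_
    refine adds_addReal rfl rfl ?_
    have hA₃ := (hA.frame F₂ (by simpa [writesReal] using hca)).frame F₃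
      (by simpa [writesReal, addReal] using hca)
    have hB₃ := (hB.frame F₂ (by simpa [writesReal] using hcb)).frame F₃
      (by simpa [writesReal, addReal] using hcb)
    simp only [RExp.eval, hA₃.eval_entry hp hq, hB₃.eval_entry hp hq]
  simpa [frobInner_eq_sum] using hcell 0 0

theorem run_shiftProg {m : Mem} (hm : HasInput eT eH Y ε m)
    (hS : HoldsMatrix eH m.real 3 (familyMoment Y)) :
    (shiftProg.run m).real 4 0 0 = 2 * ‖familyMoment Y‖ ^ 2 := by
  have hcell : SetsCell shiftProg m 4 0 0
      (0 + ∑ p, ∑ q, 2 * (familyMoment Y p q * familyMoment Y p q)) := by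
    refine setsCell_seq_adds (setsCell_setReal rfl rfl (by simp [eval_const])) fun m₂ F₂ => ?_
    refine adds_loop_loop rfl rfl rfl (hm.frame F₂ rfl rfl rfl rfl).h_eq eH _
      fun p q m₃ F₃ hp hq => ?_
    refine adds_addReal rfl rfl ?_
    have hS₃ := (hS.frame F₂ rfl).frame F₃ rfl
    simp [RExp.eval, hS₃.eval_entry hp hq, eval_const]
  simpa [← frobInner_self, frobInner_eq_sum, Finset.mul_sum] using hcell 0 0

variable (eT eH Y ε) in
/-- The input is in place and the preliminary computations have been made. -/
structure Ready (m : Mem) : Prop extends HasInput eT eH Y ε m where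
  moment : HoldsMatrix eH m.real 3 (familyMoment Y)
  shift : m.real 4 0 0 = 2 * ‖familyMoment Y‖ ^ 2

theorem Ready.frame {p : LoopProg} {m m' : Mem} (hm : Ready eT eH Y ε m)
    (hF : Frame p m m') (h0 : p.writesNat 0 = false) (h1 : p.writesNat 1 = false)
    (h2 : p.writesReal 0 = false) (h3 : p.writesReal 1 = false) (h4 : p.writesReal 3 = false)
    (h5 : p.writesReal 4 = false) : Ready eT eH Y ε m' :=
  ⟨hm.toHasInput.frame hF h0 h1 h2 h3, hm.moment.frame hF h4, by rw [hF.real 4 h5, hm.shift]⟩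

theorem run_formProg {m : Mem} {b : ℕ} {B : Matrix ι ι ℝ} (hb : b ≠ 6) (hm : Ready eT eH Y ε m)
    (hB : HoldsMatrix eH m.real b B) :
    HoldsVector eT ((formProg b).run m).real 6 fun x => frobInner B (deviation Y x) := by
  refine column_loop rfl hm.n_eq eT _ fun x m₁ F₁ hx => ?_
  rw [frobInner_deviation_eq_sum, ← zero_add (∑ _, _)]
  refine setsCell_seq_adds (setsCell_setReal hx rfl (by simp [eval_const])) fun m₂ F₂ => ?_
  have hm₂ := (hm.frame F₁ rfl rfl rfl rfl rfl rfl).frame F₂ rfl rfl rfl rfl rfl rfl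
  rw [← F₂.nat 4 rfl] at hx
  refine adds_loop_loop rfl rfl rfl hm₂.h_eq eH _ fun p q m₃ F₃ hp hq => ?_
  have hm₃ := hm₂.frame F₃ rfl rfl rfl rfl rfl rfl
  rw [← F₃.nat 4 rfl] at hx
  have hB₃ := ((hB.frame F₁ (by simpa [writesReal, addReal] using hb.symm)).frame F₂
    (by simpa [writesReal] using hb.symm)).frame F₃ (by simpa [writesReal, addReal] using hb.symm)
  refine adds_addReal hx rfl ?_
  simp only [RExp.eval, hm₃.eval_coord hx hp, hm₃.eval_coord hx hq, hB₃.eval_entry hp hq,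
    hm₃.moment.eval_entry hp hq]

theorem run_prodProg {m : Mem} {B : Matrix ι ι ℝ} (hm : Ready eT eH Y ε m)
    (hB : HoldsMatrix eH m.real 5 B) :
    HoldsMatrix eH (prodProg.run m).real 7 (familyMoment Y * B) := by
  refine matrix_loop rfl rfl rfl hm.h_eq eH _ fun p q m₁ F₁ hp hq => ?_
  rw [Matrix.mul_apply, ← zero_add (∑ _, _)]
  refine setsCell_seq_adds (setsCell_setReal hp hq (by simp [eval_const])) fun m₂ F₂ => ?_
  have hm₂ := (hm.frame F₁ rfl rfl rfl rfl rfl rfl).frame F₂ rfl rfl rfl rfl rfl rfl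
  rw [← F₂.nat 2 rfl] at hp
  rw [← F₂.nat 3 rfl] at hq
  refine adds_loop rfl hm₂.h_eq eH _ fun r m₃ F₃ hr => ?_
  have hm₃ := hm₂.frame F₃ rfl rfl rfl rfl rfl rfl
  rw [← F₃.nat 2 rfl] at hp
  rw [← F₃.nat 3 rfl] at hq
  have hB₃ := ((hB.frame F₁ rfl).frame F₂ rfl).frame F₃ rfl
  refine adds_addReal hp hq ?_
  simp only [RExp.eval, hB₃.eval_entry hr hq, hm₃.moment.eval_entry hp hr]

theorem filterOp_apply_apply (Y : τ → ι → ℝ) (B : Matrix ι ι ℝ) (p q : ι) :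
    filterOp Y B p q = 2 * ‖familyMoment Y‖ ^ 2 * B p q +
      (∑ x, frobInner B (deviation Y x) * (Y x p * Y x q - familyMoment Y p q) / Fintype.card τ +
        ∑ r, (0 - 2) * ((familyMoment Y * B) p r * familyMoment Y r q)) := by
  rw [filterOp_apply, ← Finset.sum_div, ← Finset.mul_sum, ← Matrix.mul_apply]
  simp only [Matrix.sub_apply, Matrix.add_apply, Matrix.smul_apply, Matrix.sum_apply, deviation,
    Matrix.vecMulVec_apply, smul_eq_mul]
  ring

theorem run_combineProg {m : Mem} {B : Matrix ι ι ℝ} (hm : Ready eT eH Y ε m)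
    (hB : HoldsMatrix eH m.real 5 B)
    (hv : HoldsVector eT m.real 6 fun x => frobInner B (deviation Y x))
    (hW : HoldsMatrix eH m.real 7 (familyMoment Y * B)) :
    HoldsMatrix eH (combineProg.run m).real 8 (filterOp Y B) := by
  refine matrix_loop rfl rfl rfl hm.h_eq eH _ fun p q m₁ F₁ hp hq => ?_
  have hm₁ := hm.frame F₁ rfl rfl rfl rfl rfl rfl
  have hB₁ := hB.frame F₁ rfl
  rw [filterOp_apply_apply]
  refine setsCell_seq_adds (setsCell_setReal hp hq ?_) fun m₂ F₂ => ?_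
  · simp only [RExp.eval, hB₁.eval_entry hp hq, scalar, NExp.eval, hm₁.shift]
  have hm₂ := hm₁.frame F₂ rfl rfl rfl rfl rfl rfl
  rw [← F₂.nat 2 rfl] at hp
  rw [← F₂.nat 3 rfl] at hq
  refine adds_seq (adds_loop rfl hm₂.n_eq eT _ fun x m₃ F₃ hx => ?_) fun m₃ F₃ =>
    adds_loop rfl (hm₂.frame F₃ rfl rfl rfl rfl rfl rfl).h_eq eH _ fun r m₄ F₄ hr => ?_
  · have hm₃ := hm₂.frame F₃ rfl rfl rfl rfl rfl rfl
    rw [← F₃.nat 2 rfl] at hp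
    rw [← F₃.nat 3 rfl] at hq
    have hv₃ : HoldsVector eT m₃.real 6 fun x => frobInner B (deviation Y x) := by
      intro x
      rw [F₃.real 6 rfl, F₂.real 6 rfl, F₁.real 6 rfl, hv]
    refine adds_addReal hp hq ?_
    simp only [RExp.eval, hv₃.eval_item hx, hm₃.eval_coord hx hp, hm₃.eval_coord hx hq,
      hm₃.moment.eval_entry hp hq, hm₃.eval_size]
  · have hm₄ := (hm₂.frame F₃ rfl rfl rfl rfl rfl rfl).frame F₄ rfl rfl rfl rfl rfl rfl
    rw [← F₃.nat 2 rfl, ← F₄.nat 2 rfl] at hp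
    rw [← F₃.nat 3 rfl, ← F₄.nat 3 rfl] at hq
    have hW₄ := (((hW.frame F₁ rfl).frame F₂ rfl).frame F₃ rfl).frame F₄ rfl
    refine adds_addReal hp hq ?_
    simp [RExp.eval, eval_const, hW₄.eval_entry hp hr, hm₄.moment.eval_entry hr hq]

theorem run_opProg {m : Mem} {B : Matrix ι ι ℝ} (hm : Ready eT eH Y ε m)
    (hB : HoldsMatrix eH m.real 5 B) : HoldsMatrix eH (opProg.run m).real 8 (filterOp Y B) := by
  have F₁ := frame_run (formProg 5) m
  have hv := run_formProg (by norm_num) hm hB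
  have hm₁ := hm.frame F₁ rfl rfl rfl rfl rfl rfl
  have hB₁ := hB.frame F₁ rfl
  have F₂ := frame_run prodProg ((formProg 5).run m)
  refine run_combineProg (hm₁.frame F₂ rfl rfl rfl rfl rfl rfl) (hB₁.frame F₂ rfl) ?_
    (run_prodProg hm₁ hB₁)
  intro x
  rw [F₂.real 6 rfl, hv]

omit [Fintype ι] in
theorem run_copyProg {m : Mem} {a b : ℕ} {B : Matrix ι ι ℝ} (hab : b ≠ a) (hh : m.nat 0 2 = h)
    (hB : HoldsMatrix eH m.real a B) : HoldsMatrix eH ((copyProg a b).run m).real b B := by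
  refine matrix_loop rfl rfl rfl hh eH _ fun p q m₁ F₁ hp hq => ?_
  refine setsCell_setReal hp hq ?_
  exact (hB.frame F₁ (by simpa [writesReal] using hab)).eval_entry hp hq

/-- The nested loops multiply up the number of iterations. -/
theorem run_iterateProg {m : Mem} {B : Matrix ι ι ℝ} (hm : Ready eT eH Y ε m)
    (hB : HoldsMatrix eH m.real 5 B) :
    HoldsMatrix eH (iterateProg.run m).real 5 ((filterOp Y)^[h * h * h * n] B) := by
  rw [show h * h * h * n = n * h * h * h by ring, Function.iterate_mul, Function.iterate_mul,
    Function.iterate_mul]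
  refine loop_iterate rfl hm.h_eq (fun R B => HoldsMatrix eH R 5 B) _ hB fun B m₁ F₁ hB => ?_
  have hm₁ := hm.frame F₁ rfl rfl rfl rfl rfl rfl
  refine loop_iterate rfl hm₁.h_eq (fun R B => HoldsMatrix eH R 5 B) _ hB fun B m₂ F₂ hB => ?_
  have hm₂ := hm₁.frame F₂ rfl rfl rfl rfl rfl rfl
  refine loop_iterate rfl hm₂.h_eq (fun R B => HoldsMatrix eH R 5 B) _ hB fun B m₃ F₃ hB => ?_
  have hm₃ := hm₂.frame F₃ rfl rfl rfl rfl rfl rfl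
  refine loop_iterate rfl hm₃.n_eq (fun R B => HoldsMatrix eH R 5 B) _ hB fun B m₄ F₄ hB => ?_
  have hm₄ := hm₃.frame F₄ rfl rfl rfl rfl rfl rfl
  exact run_copyProg (by norm_num)
    (hm₄.frame (frame_run opProg m₄) rfl rfl rfl rfl rfl rfl).h_eq (run_opProg hm₄ hB)

theorem run_unitProg [DecidableEq ι] {m : Mem} (hm : Ready eT eH Y ε m) {p q : ι}
    (hp : m.nat 10 0 = eH.symm p) (hq : m.nat 11 0 = eH.symm q) :
    HoldsMatrix eH (unitProg.run m).real 5 (symmUnit p q) := by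
  have h0 : HoldsMatrix eH ((loop 2 2 (loop 3 2 (setReal 5 (ctr 2) (ctr 3) (const 0)))).run m).real
      5 (0 : Matrix ι ι ℝ) :=
    matrix_loop rfl rfl rfl hm.h_eq eH _ fun x y m₁ F₁ hx hy =>
      setsCell_setReal hx hy (by simp [eval_const])
  have F₁ := frame_run (loop 2 2 (loop 3 2 (setReal 5 (ctr 2) (ctr 3) (const 0)))) m
  rw [← F₁.nat 10 rfl] at hp
  rw [← F₁.nat 11 rfl] at hq
  set m₁ := (loop 2 2 (loop 3 2 (setReal 5 (ctr 2) (ctr 3) (const 0)))).run m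
  have h1 : Adds (addReal 5 (ctr 10) (ctr 11) (const 1)) m₁ 5 (eH.symm p) (eH.symm q) 1 :=
    adds_addReal hp hq (by simp [eval_const])
  have h2 : Adds (addReal 5 (ctr 11) (ctr 10) (const 1))
      ((addReal 5 (ctr 10) (ctr 11) (const 1)).run m₁) 5 (eH.symm q) (eH.symm p) 1 :=
    adds_addReal hq hp (by simp [eval_const])
  intro x y
  change ((addReal 5 (ctr 11) (ctr 10) (const 1)).run
      ((addReal 5 (ctr 10) (ctr 11) (const 1)).run m₁)).real 5 _ _ = _
  rw [h2, h1, h0]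
  simp [symmUnit, Matrix.single_apply, Fin.val_inj, eq_comm]

end Program
end SparsePCA

/-! ### Correctness of the search and of the scores -/

namespace SparsePCA

section Search

open RealRAM LoopProg

variable {n h : ℕ} {τ ι : Type*} {eT : Fin n ≃ τ} {eH : Fin h ≃ ι}
  {Y : τ → ι → ℝ} {ε : ℝ} [Fintype τ] [Fintype ι]

/-- The Rayleigh quotient of the filter operator; it is zero at the zero matrix. -/
noncomputable def rayleigh (Y : τ → ι → ℝ) (B : Matrix ι ι ℝ) : ℝ :=
  frobInner B (filterOp Y B) / frobInner B B

/-- The best outcome for the starting vectors in `done` is recorded in arrays `11` and `12`. The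
quotient in array `11` starts at zero, when array `12` does not yet hold an outcome. -/
structure Recorded (eH : Fin h ≃ ι) (Y : τ → ι → ℝ) (B : ι → ι → Matrix ι ι ℝ)
    (done : ι → ι → Prop) (R : ℕ → ℕ → ℕ → ℝ) : Prop where
  le : ∀ p q, done p q → rayleigh Y (B p q) ≤ R 11 0 0
  nonneg : 0 ≤ R 11 0 0
  eq : 0 < R 11 0 0 → ∃ p q, R 11 0 0 = rayleigh Y (B p q) ∧ HoldsMatrix eH R 12 (B p q)

theorem run_recordProg {m : Mem} {B : ι → ι → Matrix ι ι ℝ} {done : ι → ι → Prop}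
    {p q : ι} (hh : m.nat 0 2 = h) (hR : Recorded eH Y B done m.real)
    (hB : HoldsMatrix eH m.real 5 (B p q))
    (h9 : m.real 9 0 0 = frobInner (B p q) (filterOp Y (B p q)))
    (h10 : m.real 10 0 0 = frobInner (B p q) (B p q)) :
    Recorded eH Y B (fun x y => done x y ∨ x = p ∧ y = q) (recordProg.run m).real := by
  have hcond : (BExp.realLT (scalar 11) (.div (scalar 9) (scalar 10))).Holds m ↔
      m.real 11 0 0 < rayleigh Y (B p q) := by
    simp [BExp.Holds, scalar, RExp.eval, NExp.eval, h9, h10, rayleigh]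
  by_cases hlt : m.real 11 0 0 < rayleigh Y (B p q)
  · set m₁ := (setReal 11 (.lit 0) (.lit 0) (.div (scalar 9) (scalar 10))).run m with hm₁
    have hrun : recordProg.run m = (copyProg 5 12).run m₁ := by
      simp only [recordProg, run]
      rw [if_pos (hcond.2 hlt)]
      simp only [hm₁, run]
    have F₁ : Frame _ m m₁ := frame_run _ m
    have h11 : m₁.real 11 0 0 = rayleigh Y (B p q) := by
      have := setsCell_setReal (a := 11) (i := .lit 0) (j := .lit 0)
        (e := .div (scalar 9) (scalar 10)) (m := m) rfl rfl rfl 0 0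
      simpa [hm₁, scalar, RExp.eval, NExp.eval, h9, h10, rayleigh] using this
    have h11' : (recordProg.run m).real 11 0 0 = rayleigh Y (B p q) := by
      rw [hrun, (frame_run (copyProg 5 12) m₁).real 11 rfl, h11]
    refine ⟨?_, ?_, ?_⟩
    · rintro x y (hxy | ⟨rfl, rfl⟩)
      · rw [h11']; exact (hR.le x y hxy).trans hlt.le
      · rw [h11']
    · rw [h11']; exact hR.nonneg.trans hlt.le
    · refine fun _ => ⟨p, q, h11', ?_⟩
      rw [hrun]
      exact run_copyProg (by norm_num) ((congrFun (F₁.nat 0 rfl) 2).trans hh) (hB.frame F₁ rfl)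
  · have hrun : recordProg.run m = m := by
      simp only [recordProg, run]
      rw [if_neg (hcond.not.2 hlt)]
    rw [hrun]
    refine ⟨?_, hR.nonneg, hR.eq⟩
    rintro x y (hxy | ⟨rfl, rfl⟩)
    exacts [hR.le x y hxy, not_lt.1 hlt]

theorem Recorded.frame {p : LoopProg} {m m' : Mem} {B : ι → ι → Matrix ι ι ℝ}
    {done : ι → ι → Prop} (hR : Recorded eH Y B done m.real) (hF : Frame p m m')
    (h11 : p.writesReal 11 = false) (h12 : p.writesReal 12 = false) :
    Recorded eH Y B done m'.real := by
  refine ⟨?_, ?_, ?_⟩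
  · rw [hF.real 11 h11]; exact hR.le
  · rw [hF.real 11 h11]; exact hR.nonneg
  · rw [hF.real 11 h11]
    intro h0
    obtain ⟨p, q, h1, h2⟩ := hR.eq h0
    exact ⟨p, q, h1, h2.frame hF h12⟩

theorem run_candidateProg [DecidableEq ι] {m : Mem} {done : ι → ι → Prop} {p q : ι}
    (hm : Ready eT eH Y ε m) (hp : m.nat 10 0 = eH.symm p) (hq : m.nat 11 0 = eH.symm q)
    (hR : Recorded eH Y (powerIterate Y (h * h * h * n)) done m.real) :
    Recorded eH Y (powerIterate Y (h * h * h * n)) (fun x y => done x y ∨ x = p ∧ y = q)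
      (candidateProg.run m).real := by
  have F₁ := frame_run unitProg m
  have B₁ := run_unitProg hm hp hq
  have hm₁ := hm.frame F₁ rfl rfl rfl rfl rfl rfl
  have hR₁ := hR.frame F₁ rfl rfl
  set m₁ := unitProg.run m
  have F₂ := frame_run iterateProg m₁
  have B₂ := run_iterateProg hm₁ B₁
  have hm₂ := hm₁.frame F₂ rfl rfl rfl rfl rfl rfl
  have hR₂ := hR₁.frame F₂ rfl rfl
  set m₂ := iterateProg.run m₁
  have F₃ := frame_run opProg m₂
  have C₃ := run_opProg hm₂ B₂
  have B₃ := B₂.frame F₃ rfl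
  have hm₃ := hm₂.frame F₃ rfl rfl rfl rfl rfl rfl
  have hR₃ := hR₂.frame F₃ rfl rfl
  set m₃ := opProg.run m₂
  have F₄ := frame_run (innerProg 5 8 9) m₃
  have h9 := run_innerProg (c := 9) (by norm_num) (by norm_num) hm₃.h_eq B₃ C₃
  have B₄ := B₃.frame F₄ rfl
  have hm₄ := hm₃.frame F₄ rfl rfl rfl rfl rfl rfl
  have hR₄ := hR₃.frame F₄ rfl rfl
  set m₄ := (innerProg 5 8 9).run m₃
  have F₅ := frame_run (innerProg 5 5 10) m₄
  have h10 := run_innerProg (c := 10) (by norm_num) (by norm_num) hm₄.h_eq B₄ B₄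
  have B₅ := B₄.frame F₅ rfl
  have hm₅ := hm₄.frame F₅ rfl rfl rfl rfl rfl rfl
  have hR₅ := hR₄.frame F₅ rfl rfl
  rw [← F₅.real 9 rfl] at h9
  exact run_recordProg hm₅.h_eq hR₅ B₅ h9 h10

theorem Recorded.congr {B : ι → ι → Matrix ι ι ℝ} {done done' : ι → ι → Prop}
    {R : ℕ → ℕ → ℕ → ℝ} (hR : Recorded eH Y B done R) (h : ∀ x y, done' x y → done x y) :
    Recorded eH Y B done' R :=
  ⟨fun p q hpq => hR.le p q (h p q hpq), hR.nonneg, hR.eq⟩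

theorem run_searchProg [DecidableEq ι] {m : Mem} (hm : Ready eT eH Y ε m) :
    Recorded eH Y (powerIterate Y (h * h * h * n)) (fun _ _ => True) (searchProg.run m).real := by
  have F₁ := frame_run (setReal 11 (.lit 0) (.lit 0) (const 0)) m
  have hm₁ := hm.frame F₁ rfl rfl rfl rfl rfl rfl
  have h11 : ((setReal 11 (.lit 0) (.lit 0) (const 0)).run m).real 11 0 0 = 0 := by
    have := setsCell_setReal (a := 11) (i := .lit 0) (j := .lit 0)
      (e := const 0) (m := m) rfl rfl rfl 0 0
    simpa [eval_const, NExp.eval] using this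
  set m₁ := (setReal 11 (.lit 0) (.lit 0) (const 0)).run m
  have key := loop_induction (p := loop 11 2 candidateProg) (c := 10) (b := 2) rfl (m := m₁)
    (fun i R => Recorded eH Y (powerIterate Y (h * h * h * n))
      (fun x _ => (eH.symm x : ℕ) < i) R)
    ⟨by simp, h11.ge, fun h0 => absurd h11 h0.ne'⟩ (by
      intro i hi m₂ F₂ hc hI
      have hm₂ := hm₁.frame F₂ rfl rfl rfl rfl rfl rfl
      have hn : m₂.nat 0 2 = h := hm₂.h_eq
      rw [hm₁.h_eq] at hi
      have key := loop_induction (p := candidateProg) (c := 11) (b := 2) rfl (m := m₂)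
        (fun j R => Recorded eH Y (powerIterate Y (h * h * h * n))
          (fun x y => (eH.symm x : ℕ) < i ∨ (eH.symm x : ℕ) = i ∧ (eH.symm y : ℕ) < j) R)
        (hI.congr (by simp)) (by
          intro j hj m₃ F₃ hc' hJ
          have hm₃ := hm₂.frame F₃ rfl rfl rfl rfl rfl rfl
          rw [hn] at hj
          rw [← F₃.nat 10 rfl] at hc
          refine (run_candidateProg (p := eH ⟨i, hi⟩) (q := eH ⟨j, hj⟩) hm₃ (by simp [hc])
            (by simp [hc']) hJ).congr ?_
          rintro x y (hx | ⟨hx, hy⟩)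
          · exact Or.inl (Or.inl hx)
          · rcases Nat.lt_succ_iff_lt_or_eq.1 hy with hy | hy
            · exact Or.inl (Or.inr ⟨hx, hy⟩)
            · exact Or.inr ⟨eH.symm_apply_eq.1 (Fin.ext hx), eH.symm_apply_eq.1 (Fin.ext hy)⟩)
      refine key.congr fun x y hx => ?_
      rcases Nat.lt_succ_iff_lt_or_eq.1 hx with hx | hx
      · exact Or.inl hx
      · refine Or.inr ⟨hx, ?_⟩
        rw [hn]
        exact (eH.symm y).2)
  refine key.congr fun x y _ => ?_
  rw [hm₁.h_eq]
  exact (eH.symm x).2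

/-- The order by decreasing square of a form, ties being broken by the index. -/
noncomputable def scoreKey (eT : Fin n ≃ τ) (Y : τ → ι → ℝ) (B : Matrix ι ι ℝ) (x : τ) :
    ℝ ×ₗ Fin n :=
  toLex (-(frobInner B (deviation Y x) ^ 2), eT.symm x)

theorem run_rankProg {m : Mem} {B : Matrix ι ι ℝ} (hm : Ready eT eH Y ε m)
    (hv : HoldsVector eT m.real 6 fun x => frobInner B (deviation Y x)) :
    HoldsVector eT (rankProg.run m).real 13 fun x => (rank (scoreKey eT Y B) x : ℝ) := by
  refine column_loop rfl hm.n_eq eT _ fun x m₂ F₂ hx => ?_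
  have hrank : (rank (scoreKey eT Y B) x : ℝ) =
      0 + ∑ z, if scoreKey eT Y B z < scoreKey eT Y B x then (1 : ℝ) else 0 := by
    simp [rank]
  rw [hrank]
  refine setsCell_seq_adds (setsCell_setReal hx rfl (by simp [eval_const])) fun m₃ F₃ => ?_
  rw [← F₃.nat 4 rfl] at hx
  have hm₃ := (hm.frame F₂ rfl rfl rfl rfl rfl rfl).frame F₃ rfl rfl rfl rfl rfl rfl
  refine adds_loop rfl hm₃.n_eq eT _ fun z m₄ F₄ hz => ?_
  rw [← F₄.nat 4 rfl] at hx
  have hv₄ : HoldsVector eT m₄.real 6 fun x => frobInner B (deviation Y x) := by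
    intro x
    rw [F₄.real 6 rfl, F₃.real 6 rfl, F₂.real 6 rfl, hv]
  refine adds_guarded ?_ (adds_addReal hx rfl (by simp [eval_const]))
  simp only [precedes, BExp.Holds, sqForm, RExp.eval, hv₄.eval_item hx, hv₄.eval_item hz,
    eval_ctr, hx, hz, scoreKey, Prod.Lex.toLex_lt_toLex, neg_lt_neg_iff, neg_inj, ← sq,
    Fin.lt_def]
  set a := frobInner B (deviation Y x) ^ 2
  set b := frobInner B (deviation Y z) ^ 2
  constructor
  · intro hcon
    by_cases hab : a < b
    · exact Or.inl hab
    · by_cases hba : b < a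
      · exact absurd ⟨hab, fun h => h.1 hba⟩ hcon
      · refine Or.inr ⟨le_antisymm (not_lt.1 hab) (not_lt.1 hba), ?_⟩
        by_contra hlt
        exact hcon ⟨hab, fun h => hlt h.2⟩
  · rintro (hab | ⟨hab, hlt⟩) ⟨h1, h2⟩
    · exact h1 hab
    · exact h2 ⟨by rw [hab]; exact lt_irrefl _, hlt⟩

theorem run_cutProg {m : Mem} {B : Matrix ι ι ℝ} (hm : Ready eT eH Y ε m)
    (hv : HoldsVector eT m.real 6 fun x => frobInner B (deviation Y x))
    (hr : HoldsVector eT m.real 13 fun x => (rank (scoreKey eT Y B) x : ℝ)) :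
    HoldsVector eT (cutProg.run m).real 2 fun x =>
      if ε * Fintype.card τ < rank (scoreKey eT Y B) x + 1 then 0
      else frobInner B (deviation Y x) ^ 2 := by
  refine column_loop rfl hm.n_eq eT _ fun x m₃ F₃ hx => ?_
  have hm₃ := hm.frame F₃ rfl rfl rfl rfl rfl rfl
  rw [← ite_not, ← zero_add (ite _ _ _)]
  refine setsCell_seq_adds (setsCell_setReal hx rfl (by simp [eval_const])) fun m₄ F₄ => ?_
  have hm₄ := hm₃.frame F₄ rfl rfl rfl rfl rfl rfl
  rw [← F₄.nat 4 rfl] at hx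
  have hv₄ : HoldsVector eT m₄.real 6 fun x => frobInner B (deviation Y x) := fun x => by
    rw [F₄.real 6 rfl, F₃.real 6 rfl, hv]
  have hr₄ : HoldsVector eT m₄.real 13 fun x => (rank (scoreKey eT Y B) x : ℝ) := fun x => by
    rw [F₄.real 13 rfl, F₃.real 13 rfl, hr]
  refine adds_guarded ?_ (adds_addReal hx rfl ?_)
  · simp [BExp.Holds, RExp.eval, scalar, NExp.eval, hm₄.eps, hm₄.eval_size, hr₄.eval_item hx,
      eval_const]
  · simp [sqForm, RExp.eval, hv₄.eval_item hx, sq]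

theorem run_scoreProg {m : Mem} {B : Matrix ι ι ℝ} (hm : Ready eT eH Y ε m)
    (hB : HoldsMatrix eH m.real 12 B) :
    HoldsVector eT (scoreProg.run m).real 2 fun x =>
      if ε * Fintype.card τ < rank (scoreKey eT Y B) x + 1 then 0
      else frobInner B (deviation Y x) ^ 2 := by
  have F₁ := frame_run (formProg 12) m
  have hv := run_formProg (by norm_num) hm hB
  have hm₁ := hm.frame F₁ rfl rfl rfl rfl rfl rfl
  set m₁ := (formProg 12).run m
  have F₂ := frame_run rankProg m₁
  have hm₂ := hm₁.frame F₂ rfl rfl rfl rfl rfl rfl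
  have hr := run_rankProg hm₁ hv
  refine run_cutProg hm₂ ?_ hr
  intro x
  rw [F₂.real 6 rfl, hv]

/-- The filter, once the recorded outcome of the power iteration is known to be non-trivial. -/
theorem run_filterProg [DecidableEq ι] {m : Mem} (hm : HasInput eT eH Y ε m) {p₀ q₀ : ι}
    (hpos : 0 < rayleigh Y (powerIterate Y (h * h * h * n) p₀ q₀)) :
    ∃ p q, rayleigh Y (powerIterate Y (h * h * h * n) p₀ q₀) ≤
        rayleigh Y (powerIterate Y (h * h * h * n) p q) ∧
      ∀ x, (filterProg.run m).real 2 (eT.symm x) 0 =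
        if ε * Fintype.card τ <
          rank (scoreKey eT Y (powerIterate Y (h * h * h * n) p q)) x + 1 then 0
        else frobInner (powerIterate Y (h * h * h * n) p q) (deviation Y x) ^ 2 := by
  have F₁ := frame_run momentProg m
  have hS := run_momentProg hm
  have hm₁ := hm.frame F₁ rfl rfl rfl rfl
  set m₁ := momentProg.run m
  have F₂ := frame_run shiftProg m₁
  have hs := run_shiftProg hm₁ hS
  have hm₂ : Ready eT eH Y ε (shiftProg.run m₁) :=
    ⟨hm₁.frame F₂ rfl rfl rfl rfl, hS.frame F₂ rfl, hs⟩
  set m₂ := shiftProg.run m₁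
  have F₃ := frame_run searchProg m₂
  have hR := run_searchProg hm₂
  have hm₃ := hm₂.frame F₃ rfl rfl rfl rfl rfl rfl
  have hle := hR.le p₀ q₀ trivial
  obtain ⟨p, q, h11, hB⟩ := hR.eq (hpos.trans_le hle)
  exact ⟨p, q, hle.trans_eq h11, fun x => run_scoreProg hm₃ hB x⟩

end Search
end SparsePCA

/-! ### Assembly -/

namespace SparsePCA

section Assembly

variable {d : ℕ} {S T : Finset (EuclideanSpace ℝ (Fin d))} {H : Finset (Fin d)}
  {v : EuclideanSpace ℝ (Fin d)} {ε γ η : ℝ}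

theorem principal_spiked (H : Finset (Fin d)) (v : EuclideanSpace ℝ (Fin d)) (η : ℝ) :
    principal H (1 + η • outer v) =
      1 + η • Matrix.vecMulVec (fun i : H => v i) (fun i : H => v i) := by
  ext i j
  by_cases hij : i = j
  · subst hij
    simp [principal, outer, Matrix.vecMulVec_apply]
  · have hij' : (i : Fin d) ≠ j := fun h => hij (Subtype.ext h)
    simp [principal, outer, Matrix.vecMulVec_apply, Matrix.one_apply_ne, hij, hij']

theorem dotProduct_restrict_le (hv : ‖v‖ = 1) :
    (fun i : H => v i) ⬝ᵥ (fun i : H => v i) ≤ 1 := by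
  have h1 : ∑ i, v i * v i = 1 := by
    have := EuclideanSpace.norm_sq_eq v
    rw [hv] at this
    simpa [sq] using this.symm
  rw [dotProduct, Finset.sum_coe_sort H fun i => v i * v i, ← h1]
  exact Finset.sum_le_univ_sum_of_nonneg fun i => mul_self_nonneg _

theorem norm_spiked_sq_le {ι : Type*} [Fintype ι] [DecidableEq ι] [Nonempty ι] {u : ι → ℝ}
    (h0 : 0 ≤ η) (h1 : η ≤ 1) (hu : u ⬝ᵥ u ≤ 1) :
    ‖(1 + η • Matrix.vecMulVec u u : Matrix ι ι ℝ)‖ ^ 2 ≤ 4 * Fintype.card ι := by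
  have e1 : frobInner (1 : Matrix ι ι ℝ) 1 = Fintype.card ι := by
    simp [frobInner_eq_trace]
  have e2 : frobInner (1 : Matrix ι ι ℝ) (Matrix.vecMulVec u u) = u ⬝ᵥ u := by
    simp [frobInner_eq_trace, Matrix.trace_vecMulVec]
  have e3 : frobInner (Matrix.vecMulVec u u) (Matrix.vecMulVec u u) = (u ⬝ᵥ u) * (u ⬝ᵥ u) := by
    rw [frobInner_self, norm_vecMulVec]
  have hu0 : 0 ≤ u ⬝ᵥ u := Finset.sum_nonneg fun _ _ => mul_self_nonneg _
  have hc : (1 : ℝ) ≤ Fintype.card ι := by exact_mod_cast Fintype.card_pos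
  rw [← frobInner_self]
  simp only [map_add, map_smul, LinearMap.add_apply, LinearMap.smul_apply, smul_eq_mul, e1, e2, e3,
    frobInner_comm (Matrix.vecMulVec u u) 1]
  have f1 : η * (u ⬝ᵥ u) ≤ 1 := mul_le_one₀ h1 hu0 hu
  have f2 : 0 ≤ η * (u ⬝ᵥ u) := mul_nonneg h0 hu0
  have f3 : η * (η * ((u ⬝ᵥ u) * (u ⬝ᵥ u))) ≤ 1 := by nlinarith
  linarith

theorem momentError_eq_principal :
    momentError T (fun x (i : H) => x i) (principal H (1 + η • outer v)) =
      principal H (secondMoment T - 1 - η • outer v) := by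
  ext i j
  have := Finset.sum_coe_sort T fun x => x i * x j
  simp only [momentError, familyMoment, principal, secondMoment, avg, Matrix.sub_apply,
    Matrix.of_apply, Matrix.submatrix_apply, Matrix.add_apply, Fintype.card_coe, this]
  ring

open Classical in
theorem IsPCAStable.corruptedPair {k : ℕ} (hε : ε < 1 / 1000) (hη : η < 1) (hS : S.Nonempty)
    (hst : IsPCAStable S ε γ k η v) (hT : IsCorruption ε S T) (hH : H.card ≤ k) :
    CorruptedPair ε γ S T (fun x (i : H) => x i) (principal H (1 + η • outer v)) where
  eps_pos := hst.eps_pos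
  eps_le := hst.eps_le
  eps_small := hε.le
  nonempty := hS
  card_eq := hT.1
  card_inter := hT.2
  stable := hst.covariance H hH
  symm := by
    rw [principal_spiked]
    ext i j
    simp [Matrix.vecMulVec_apply, Matrix.one_apply, mul_comm, eq_comm]
  le_trace B hB := (trace_spiked_bounds hB hst.eta_nonneg hη.le (dotProduct_restrict_le hst.unit)
    (principal_spiked H v η)).1
  trace_le B hB := (trace_spiked_bounds hB hst.eta_nonneg hη.le (dotProduct_restrict_le hst.unit)
    (principal_spiked H v η)).2
  trace_sub_le B hB A := abs_trace_sub_trace_spiked_le hB hst.eta_nonneg hη.le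
    (dotProduct_restrict_le hst.unit) (principal_spiked H v η) A

theorem hasInput_input (eT : Fin T.card ≃ T) (eH : Fin H.card ≃ H) :
    HasInput eT eH (fun (x : T) (i : H) => x.val i) ε (input eT eH ε γ η) where
  n_eq := by simp [input]
  h_eq := by simp [input]
  points x p := by simp [input]
  eps := by simp [input]

theorem scoreKey_injective {n : ℕ} {τ ι : Type*} [Fintype τ] [Fintype ι] (eT : Fin n ≃ τ)
    (Y : τ → ι → ℝ) (B : Matrix ι ι ℝ) : Function.Injective (scoreKey eT Y B) := by
  intro x z h
  have := congrArg (fun w => (ofLex w).2) h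
  simpa [scoreKey] using this

theorem sq_le_of_scoreKey_le {n : ℕ} {τ ι : Type*} [Fintype τ] [Fintype ι] {eT : Fin n ≃ τ}
    {Y : τ → ι → ℝ} {B : Matrix ι ι ℝ} {x z : τ} (h : scoreKey eT Y B x ≤ scoreKey eT Y B z) :
    frobInner B (deviation Y z) ^ 2 ≤ frobInner B (deviation Y x) ^ 2 := by
  rw [scoreKey, scoreKey, Prod.Lex.toLex_le_toLex] at h
  rcases h with h | h
  · simp only [neg_lt_neg_iff] at h; exact h.le
  · have := h.1
    simp only [neg_inj] at this
    exact this.ge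

theorem ne_zero_of_rayleigh_pos {τ ι : Type*} [Fintype τ] [Fintype ι] {Y : τ → ι → ℝ}
    {B : Matrix ι ι ℝ} (h : 0 < rayleigh Y B) : B ≠ 0 := by
  rintro rfl
  simp [rayleigh] at h

/-- The scores that the filter computes are filter scores. -/
theorem isFilterScore_run {k : ℕ} (hε : ε < 1 / 1000) (hη : η < 1) (hS : S.Nonempty)
    (hst : IsPCAStable S ε γ k η v) (hT : IsCorruption ε S T) (hH : H.card ≤ k)
    (ha : 800 * γ ≤ ‖principal H (secondMoment T - 1 - η • outer v)‖) [Nonempty H]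
    (eT : Fin T.card ≃ T) (eH : Fin H.card ≃ H) :
    IsFilterScore S T (output eT (filterProg.run (input eT eH ε γ η))) := by
  classical
  have hP := hst.corruptedPair hε hη hS hT hH
  rw [← momentError_eq_principal] at ha
  have hSig : ‖principal H (1 + η • outer v)‖ ^ 2 ≤ 4 * Fintype.card H := by
    rw [principal_spiked]
    exact norm_spiked_sq_le hst.eta_nonneg hη.le (dotProduct_restrict_le hst.unit)
  obtain ⟨p₀, q₀, h₀⟩ := hP.exists_powerIterate hSig ha
    (L := H.card * H.card * H.card * T.card) (by rw [Fintype.card_coe, hP.card_eq])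
  set Y : T → H → ℝ := fun x i => x.val i with hY
  set A := momentError T (fun x (i : H) => x i) (principal H (1 + η • outer v))
  have hA : 0 < ‖A‖ := hP.sq_error_pos ha
  have hε0 := hst.eps_pos
  have hB₀ : 0 < ‖powerIterate Y (H.card * H.card * H.card * T.card) p₀ q₀‖ ^ 2 := by
    have : powerIterate Y (H.card * H.card * H.card * T.card) p₀ q₀ ≠ 0 := by
      intro h
      rw [h] at h₀
      simp at h₀
    have := norm_pos_iff.2 this
    positivity
  have hr₀ : 2 * ‖familyMoment Y‖ ^ 2 + ‖A‖ ^ 2 / (10 * ε) <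
      rayleigh Y (powerIterate Y (H.card * H.card * H.card * T.card) p₀ q₀) := by
    rw [rayleigh, frobInner_self, lt_div_iff₀ hB₀]
    exact h₀
  obtain ⟨p, q, hle, hrun⟩ := run_filterProg (hasInput_input (γ := γ) (η := η) (ε := ε) eT eH)
    (lt_trans (by positivity) hr₀)
  set B := powerIterate Y (H.card * H.card * H.card * T.card) p q with hB
  have hrB := hr₀.trans_le hle
  have hB0 : B ≠ 0 := ne_zero_of_rayleigh_pos (lt_trans (by positivity) hrB)
  have hBpos : 0 < ‖B‖ ^ 2 := by
    have := norm_pos_iff.2 hB0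
    positivity
  have hex : ‖A‖ ^ 2 / (10 * ε) * ‖B‖ ^ 2 ≤ excess Y B := by
    rw [rayleigh, frobInner_self, frobInner_self_filterOp, lt_div_iff₀ hBpos] at hrB
    linarith
  have hcard : ((Fintype.card T : ℕ) : ℝ) = S.card := by rw [Fintype.card_coe, hP.card_eq]
  have := hP.score ha (powerIterate_isSymm Y _ p q) hB0 hex (scoreKey_injective eT Y B)
    (fun x z => sq_le_of_scoreKey_le) (f := output eT (filterProg.run (input eT eH ε γ η)))
    (fun x => by rw [output, hrun x, hcard])
  unfold IsFilterScore
  convert this using 3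

end Assembly

end SparsePCA

/-- There is one program, uniform in all parameters, that computes the scores within
`d * poly(k, |T|)` steps. -/
theorem mainTheorem7 :
    ∃ ε₀ : ℝ, 0 < ε₀ ∧ ∃ C₀ : ℝ, 0 < C₀ ∧ ∃ (P : RealRAM.Prog) (a : ℕ),
      ∀ (C : ℝ), C₀ ≤ C →
      ∀ (d k : ℕ) (ε γ η : ℝ) (v : EuclideanSpace ℝ (Fin d))
        (S T : Finset (EuclideanSpace ℝ (Fin d))) (H : Finset (Fin d)),
        0 < ε → ε < ε₀ → 0 < η → η < 1 →
        S.Nonempty →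
        SparsePCA.IsPCAStable S ε γ k η v →
        SparsePCA.IsCorruption ε S T →
        H.card ≤ k →
        8 * C * γ ≤
          ‖SparsePCA.principal H (SparsePCA.secondMoment T - 1 - η • SparsePCA.outer v)‖ →
        ∀ (eT : Fin T.card ≃ T) (eH : Fin H.card ≃ H),
          ∃ (m : RealRAM.Mem) (t : ℕ),
            RealRAM.Exec P (SparsePCA.input eT eH ε γ η) m t ∧
            t ≤ d * (a * (k + T.card) ^ a) ∧
            SparsePCA.IsFilterScore S T (SparsePCA.output eT m) := by
  -- `8 * 100 = 800` is the ratio of `a` to `γ` that the statistical lemmas need. The weight and the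
  -- depth of the program are both majorized by their sum, which serves as factor and as exponent.
  refine ⟨1 / 1000, by norm_num, 100, by norm_num, SparsePCA.filterProg.compile,
    SparsePCA.filterProg.weight + SparsePCA.filterProg.depth, ?_⟩
  intro C hC d k ε γ η v S T H hε hε₀ _ hη hS hst hT hH hbig eT eH
  have hγ : 0 < γ := hε.trans_le hst.eps_le
  have ha : 800 * γ ≤
      ‖SparsePCA.principal H (SparsePCA.secondMoment T - 1 - η • SparsePCA.outer v)‖ := by
    nlinarith
  -- The norm of the error is positive, so that `H` is nonempty and `d` at least one.
  have hHne : Nonempty H := by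
    by_contra hne
    rw [not_nonempty_iff] at hne
    rw [Subsingleton.elim (SparsePCA.principal H _) 0, norm_zero] at ha
    linarith
  have hd : 1 ≤ d := by
    obtain ⟨i, _⟩ := hHne
    have := i.2
    omega
  have hX : 1 ≤ k + T.card := by
    have := hS.card_pos
    have := hT.1
    omega
  obtain ⟨t, ht, htX⟩ := RealRAM.LoopProg.exists_exec SparsePCA.filterProg_wf hX
    (m := SparsePCA.input eT eH ε γ η) (by simp [SparsePCA.input])
    (by simp [SparsePCA.input]; omega)
  refine ⟨_, t, ht, ?_, SparsePCA.isFilterScore_run hε₀ hη hS hst hT hH ha eT eH⟩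
  calc t ≤ SparsePCA.filterProg.weight * (k + T.card) ^ SparsePCA.filterProg.depth := htX
    _ ≤ (SparsePCA.filterProg.weight + SparsePCA.filterProg.depth) *
        (k + T.card) ^ (SparsePCA.filterProg.weight + SparsePCA.filterProg.depth) :=
      Nat.mul_le_mul (Nat.le_add_right _ _) (Nat.pow_le_pow_right hX (Nat.le_add_left _ _))
    _ ≤ _ := Nat.le_mul_of_pos_left _ hd
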